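/- **Model.** Let $T\in\mathbb N$, $0<\alpha\le 1$, $c_0,\dots,c_T\in\mathbb R$, $K_0,\dots,K_{T-1}\ge 0$, let $D_0,\dots,D_{T-1}$ be independent, non-negative, integrable random variables with distribution functions $F_t$, and let $G_0,\dots,G_{T-1}:\mathbb R\to\mathbb R$ (one-period expected holding and penalty costs). Put $\delta(z)=1$ for $z>0$, $\delta(0)=0$. The optimal costs are given by $v_T(x)=-c_Tx$ and, for $t<T$, $$v_t(x)=\min_{y\ge x}\{K_t\delta(y-x)+c_t(y-x)+G_t(y)+\alpha E[v_{t+1}(y-D_t)]\}.$$ Put $V^*_t(x)=v_t(x)+c_tx$, $C_t(y)=(c_t-\alpha c_{t+1})y+G_t(y)+\alpha c_{t+1}E[D_t]$ and $H^*_t(y)=C_t(y)+\alpha E[V^*_{t+1}(y-D_t)]$. **Assumptions.** Each $C_t$ ($0\le t\le T-1$) is convex with $C_t(y)\to+\infty$ as $|y|\to\infty$; $K_t\ge\alpha K_{t+1}$ for $0\le t\le T-2$; and for $0\le t\le T-1$ there is $\gamma_t\ge0$ with $|C_t(x)-C_t(y)|\le\gamma_t|x-y|$ for all $x,y$. Fix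 such $\gamma_t$. **Discretized recursion.** Fix $\theta>0$; let $z_m=m\theta$ ($m\in\mathbb Z$) and $f_t(n)=F_t(z_{n+1})-F_t(z_n)$. Let $C^m_t$ be the smallest minimizer of $C_t$, and $$S^U_t=\min\{z_m: C_t(z_m)>C_t(z_{n_0})+K_t,\ z_m\ge C^m_t\},\qquad z_{n_0}<C^m_t\le z_{n_0+1}.$$ Let $\bar I_{T-1}=s_{T-1}$ be the point $\bar Y\le C^m_{T-1}$ with $C_{T-1}(\bar Y)=C_{T-1}(C^m_{T-1})+K_{T-1}$, and for $t=T-2,\dots,0$ let $$I_t=\max\{z_m: z_m<\min(\bar I_{t+1}-\theta,\,C^m_t)\},\qquad \bar I_t=\max\{z_m: C_t(z_m)>C_t(I_t)+K_t,\ z_m\le I_t\}+\theta .$$ Let $H_{T-1}=C_{T-1}$, $S_{T-1}=C^m_{T-1}$, and for all $t$ let $V_t(y)=H_t(S_t)+K_t$ if $y<s_t$ and $V_t(y)=H_t(y)$ if $y\ge s_t$, where for $t=T-2,\dots,0$ $$H_t(y)=C_t(y)+\alpha\sum_{n=-1}^\infty V_{t+1}(y-z_n)f_t(n),$$ $S_t$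 is the largest minimizer of $H_t$ over the grid points $z_m$ with $I_t\le z_m\le S^U_t$, and $s_t=S_t$ if $K_t=0$, while $s_t=\min\{z_m: H_t(z_m)\le H_t(S_t)+K_t,\ \bar I_t\le z_m\le S_t\}$ if $K_t>0$. (All these minima and maxima exist under the assumptions.) **Estimate functions.** Let $\psi_{T-1}(x,y)=\bar\psi_{T-1}(x,y)=\gamma_{T-1}x$, and let $\varphi_{T-1}(x,y)=\bar\varphi_{T-1}(x,y)$ be $0$ if $y<s_{T-1}$ and $\gamma_{T-1}x$ if $y\ge s_{T-1}$. For $t=T-2,\dots,0$ let $$\psi_t(x,y)=\begin{cases}\gamma_tx,& y<s_{t+1}-\theta,\\ \gamma_tx+\alpha\sum_{m=-1}^{n-1}\varphi_{t+1}(x,y-z_m)f_t(m),& y\ge s_{t+1}-\theta,\end{cases}\qquad z_{n-1}\le y-s_{t+1}<z_n,$$ $$\varphi_t(x,y)=\begin{cases}0,&y<s_t,\\ \psi_t(y-s_t,y),& y\ge s_t,\ y-x<s_t,\\ \psi_t(x,y),&y\ge s_t,\ y-x\ge s_t;\end{cases}$$ $\bar\psi_t$ is given by the same formula with $\bar\varphi_{t+1}$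 in place of $\varphi_{t+1}$, and $\bar\varphi_t$ by the same formula as $\varphi_t$ with $\bar\psi_t$ in place of $\psi_t$ and middle case $\bar\psi_t(y-s_t+\theta,y)$. Finally let $\omega_{T-1}=\bar\omega_{T-1}=0$ and, for $t=T-2,\dots,0$, $$\omega_t(x)=\psi_t(\theta,x)-\gamma_t\theta+\alpha\sum_{n=-1}^\infty\bar\omega_{t+1}(x-z_n)f_t(n),\qquad \eta_t=\bar\psi_t(\theta,S^U_t)+\omega_t(S^U_t),$$ and $\bar\omega_t(x)=\eta_t$ if $x\le S^U_t$, $\bar\omega_t(x)=\max(\eta_t,\omega_t(x))$ if $x>S^U_t$. **Theorem.** For every $t=0,1,\dots,T-1$ and every $x\in\mathbb R$, $$H_t(x)-H^*_t(x)\le\omega_t(x)\qquad\text{and}\qquad V_t(x)-V^*_t(x)\le\bar\omega_t(x).$$ -/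

import Mathlib

open MeasureTheory ProbabilityTheory Filter

/-- A finite-horizon non-stationary inventory system with setup costs and full backlogging.
Periods are `0, …, T`; only the data with index `< T` (and the salvage value `c T`) matter.
All demands live on one probability space `(Ω, P)`. -/
structure InventorySystem {Ω : Type*} [MeasurableSpace Ω] (P : Measure Ω) where
  /-- number of ordering periods -/
  T : ℕ
  /-- discount factor -/
  α : ℝ
  /-- unit ordering costs; `c T` is the salvage value -/
  c : ℕ → ℝ
  /-- setup costs -/
  K : ℕ → ℝ
  /-- expected holding and penalty cost in a period, as a function of the level after ordering -/
  G : ℕ → ℝ → ℝ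
  /-- demands -/
  D : ℕ → Ω → ℝ
  α_pos : 0 < α
  α_le_one : α ≤ 1
  K_nonneg : ∀ t < T, 0 ≤ K t
  D_measurable : ∀ t < T, Measurable (D t)
  D_nonneg : ∀ t < T, ∀ᵐ ω ∂P, 0 ≤ D t ω
  D_integrable : ∀ t < T, Integrable (D t) P
  D_indep : iIndepFun (fun t : Fin T => D t) P

namespace InventorySystem

noncomputable section

variable {Ω : Type*} [MeasurableSpace Ω] {P : Measure Ω} (M : InventorySystem P)

/-! ### The exact problem -/

/-- `δ z = 1` if `z > 0` and `δ 0 = 0`. -/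
def delta (z : ℝ) : ℝ := if 0 < z then 1 else 0

/-- Minimal expected discounted cost from period `t` on, by backward recursion:
`v_T(x) = -c_T x` and
`v_t(x) = min_{y ≥ x} { K_t δ(y-x) + c_t (y-x) + G_t(y) + α E[v_{t+1}(y - D_t)] }`. -/
def v (t : ℕ) : ℝ → ℝ :=
  if _h : t < M.T then fun x =>
    ⨅ y : Set.Ici x, (M.K t * delta ((y : ℝ) - x) + M.c t * ((y : ℝ) - x) + M.G t y
      + M.α * ∫ ω, v (t + 1) ((y : ℝ) - M.D t ω) ∂P)
  else fun x => -(M.c M.T * x)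
termination_by M.T - t
decreasing_by omega

/-- `V*_t(x) = v_t(x) + c_t x`. -/
def Vstar (t : ℕ) (x : ℝ) : ℝ := M.v t x + M.c t * x

/-- `C_t(y) = (c_t - α c_{t+1}) y + G_t(y) + α c_{t+1} E[D_t]`. -/
def C (t : ℕ) (y : ℝ) : ℝ :=
  (M.c t - M.α * M.c (t + 1)) * y + M.G t y + M.α * M.c (t + 1) * ∫ ω, M.D t ω ∂P

/-- `H*_t(y) = C_t(y) + α E[V*_{t+1}(y - D_t)]`. -/
def Hstar (t : ℕ) (y : ℝ) : ℝ := M.C t y + M.α * ∫ ω, M.Vstar (t + 1) (y - M.D t ω) ∂P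

/-! ### The discretized recursion, with mesh `θ > 0` -/

/-- The grid points `z_m = m θ`. -/
def z (θ : ℝ) (m : ℤ) : ℝ := m * θ

/-- The distribution function of `D_t`. -/
def F (t : ℕ) (x : ℝ) : ℝ := cdf (P.map (M.D t)) x

/-- `f_t(n) = F_t(z_{n+1}) - F_t(z_n)`. -/
def f (θ : ℝ) (t : ℕ) (n : ℤ) : ℝ := M.F t (z θ (n + 1)) - M.F t (z θ n)

/-- `∑_{n = -1}^∞ g(x - z_n) f_t(n)`, the discretized version of `E[g(x - D_t)]`. -/
def discExp (θ : ℝ) (t : ℕ) (g : ℝ → ℝ) (x : ℝ) : ℝ :=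
  ∑' k : ℕ, g (x - z θ ((k : ℤ) - 1)) * M.f θ t ((k : ℤ) - 1)

/-- `C^m_t`: the smallest minimizer of `C_t`. -/
def Cm (t : ℕ) : ℝ := sInf {y | ∀ x, M.C t y ≤ M.C t x}

/-- `S^U_t`: the smallest grid point `z_m ≥ C^m_t` with `C_t(z_m) > C_t(z_{n₀}) + K_t`, where
`z_{n₀} < C^m_t ≤ z_{n₀+1}`. -/
def SU (θ : ℝ) (t : ℕ) : ℝ :=
  sInf {w | ∃ m n₀ : ℤ, w = z θ m ∧ z θ n₀ < M.Cm t ∧ M.Cm t ≤ z θ (n₀ + 1) ∧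
    M.C t (z θ n₀) + M.K t < M.C t (z θ m) ∧ M.Cm t ≤ z θ m}

/-- The point `y ≤ C^m_t` with `C_t(y) = C_t(C^m_t) + K_t`, used in the last period `t = T - 1`
(it is unique when `C_t` is convex and coercive). -/
def Ybar (t : ℕ) : ℝ := sSup {y | M.C t y = M.C t (M.Cm t) + M.K t ∧ y ≤ M.Cm t}

/-- The largest grid point below `min (J - θ) C^m_t`; `I_t` is its value at `J = Ī_{t+1}`. -/
def IOf (θ : ℝ) (t : ℕ) (J : ℝ) : ℝ :=
  sSup {w | ∃ m : ℤ, w = z θ m ∧ z θ m < min (J - θ) (M.Cm t)}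

/-- `Ī_t`: for `t = T - 1` it is `s_{T-1}`; for `t ≤ T - 2` it is
`max {z_m | C_t(z_m) > C_t(I_t) + K_t, z_m ≤ I_t} + θ`. -/
def Ibar (θ : ℝ) (t : ℕ) : ℝ :=
  if _h : t + 1 < M.T then
    sSup {w | ∃ m : ℤ, w = z θ m ∧
      M.C t (M.IOf θ t (Ibar θ (t + 1))) + M.K t < M.C t (z θ m) ∧
      z θ m ≤ M.IOf θ t (Ibar θ (t + 1))} + θ
  else M.Ybar t
termination_by M.T - t
decreasing_by omega

/-- `I_t`, for `t ≤ T - 2`. -/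
def I (θ : ℝ) (t : ℕ) : ℝ := M.IOf θ t (M.Ibar θ (t + 1))

/-- The order-up-to level computed in period `t` from the function `h` (which will be `H_t`):
for `t ≤ T - 2` the largest minimizer of `h` among the grid points in `[I_t, S^U_t]`, for
`t = T - 1` the point `C^m_{T-1}`. -/
def SOf (θ : ℝ) (t : ℕ) (h : ℝ → ℝ) : ℝ :=
  if t + 1 < M.T then
    sSup {w | ∃ m : ℤ, w = z θ m ∧ M.I θ t ≤ z θ m ∧ z θ m ≤ M.SU θ t ∧
      ∀ n : ℤ, M.I θ t ≤ z θ n → z θ n ≤ M.SU θ t → h (z θ m) ≤ h (z θ n)}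
  else M.Cm t

/-- The reorder level computed in period `t` from the function `h` (which will be `H_t`). -/
def sOf (θ : ℝ) (t : ℕ) (h : ℝ → ℝ) : ℝ :=
  if t + 1 < M.T then
    if M.K t = 0 then M.SOf θ t h
    else sInf {w | ∃ m : ℤ, w = z θ m ∧ h (z θ m) ≤ h (M.SOf θ t h) + M.K t ∧
      M.Ibar θ t ≤ z θ m ∧ z θ m ≤ M.SOf θ t h}
  else M.Ybar t

/-- The function `V_t` obtained from `h = H_t`. -/
def VOf (θ : ℝ) (t : ℕ) (h : ℝ → ℝ) (y : ℝ) : ℝ :=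
  if y < M.sOf θ t h then h (M.SOf θ t h) + M.K t else h y

/-- `H_{T-1} = C_{T-1}` and `H_t(y) = C_t(y) + α ∑_{n ≥ -1} V_{t+1}(y - z_n) f_t(n)`. -/
def H (θ : ℝ) (t : ℕ) : ℝ → ℝ :=
  if _h : t + 1 < M.T then fun y =>
    M.C t y + M.α * M.discExp θ t (M.VOf θ (t + 1) (H θ (t + 1))) y
  else M.C t
termination_by M.T - t
decreasing_by omega

/-- The approximate order-up-to level `S_t`. -/
def S (θ : ℝ) (t : ℕ) : ℝ := M.SOf θ t (M.H θ t)

/-- The approximate reorder level `s_t`. -/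
def s (θ : ℝ) (t : ℕ) : ℝ := M.sOf θ t (M.H θ t)

/-- `V_t(y) = H_t(S_t) + K_t` for `y < s_t` and `V_t(y) = H_t(y)` for `y ≥ s_t`. -/
def V (θ : ℝ) (t : ℕ) : ℝ → ℝ := M.VOf θ t (M.H θ t)

/-! ### The estimate functions, with Lipschitz constants `γ_t` of `C_t` -/

/-- `φ_t` obtained from `p = ψ_t`. -/
def phiOf (θ : ℝ) (γ : ℕ → ℝ) (t : ℕ) (p : ℝ → ℝ → ℝ) (x y : ℝ) : ℝ :=
  if y < M.s θ t then 0
  else if t + 1 < M.T then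
    if y - x < M.s θ t then p (y - M.s θ t) y else p x y
  else γ t * x

/-- `ψ_t`. The upper summation index `n - 1` with `z_{n-1} ≤ y - s_{t+1} < z_n` is
`⌊(y - s_{t+1}) / θ⌋`. -/
def psi (θ : ℝ) (γ : ℕ → ℝ) (t : ℕ) : ℝ → ℝ → ℝ :=
  if _h : t + 1 < M.T then fun x y =>
    if y < M.s θ (t + 1) - θ then γ t * x
    else γ t * x + M.α * ∑ m ∈ Finset.Icc (-1 : ℤ) ⌊(y - M.s θ (t + 1)) / θ⌋,
      M.phiOf θ γ (t + 1) (psi θ γ (t + 1)) x (y - z θ m) * M.f θ t m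
  else fun x _ => γ t * x
termination_by M.T - t
decreasing_by omega

/-- `φ̄_t` obtained from `p = ψ̄_t`. -/
def phiBarOf (θ : ℝ) (γ : ℕ → ℝ) (t : ℕ) (p : ℝ → ℝ → ℝ) (x y : ℝ) : ℝ :=
  if y < M.s θ t then 0
  else if t + 1 < M.T then
    if y - x < M.s θ t then p (y - M.s θ t + θ) y else p x y
  else γ t * x

/-- `ψ̄_t`. -/
def psiBar (θ : ℝ) (γ : ℕ → ℝ) (t : ℕ) : ℝ → ℝ → ℝ :=
  if _h : t + 1 < M.T then fun x y =>
    if y < M.s θ (t + 1) - θ then γ t * x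
    else γ t * x + M.α * ∑ m ∈ Finset.Icc (-1 : ℤ) ⌊(y - M.s θ (t + 1)) / θ⌋,
      M.phiBarOf θ γ (t + 1) (psiBar θ γ (t + 1)) x (y - z θ m) * M.f θ t m
  else fun x _ => γ t * x
termination_by M.T - t
decreasing_by omega

/-- `ω̄_t` obtained from `w = ω_t`, for `t ≤ T - 2`: with `η_t = ψ̄_t(θ, S^U_t) + ω_t(S^U_t)`, it
is `η_t` for `x ≤ S^U_t` and `max(η_t, ω_t(x))` for `x > S^U_t`. For `t = T - 1` it is `0`. -/
def omegaBarOf (θ : ℝ) (γ : ℕ → ℝ) (t : ℕ) (w : ℝ → ℝ) (x : ℝ) : ℝ :=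
  if t + 1 < M.T then
    if x ≤ M.SU θ t then M.psiBar θ γ t θ (M.SU θ t) + w (M.SU θ t)
    else max (M.psiBar θ γ t θ (M.SU θ t) + w (M.SU θ t)) (w x)
  else 0

/-- `ω_{T-1} = 0` and
`ω_t(x) = ψ_t(θ, x) - γ_t θ + α ∑_{n ≥ -1} ω̄_{t+1}(x - z_n) f_t(n)`. -/
def omega (θ : ℝ) (γ : ℕ → ℝ) (t : ℕ) : ℝ → ℝ :=
  if _h : t + 1 < M.T then fun x =>
    M.psi θ γ t θ x - γ t * θ
      + M.α * M.discExp θ t (M.omegaBarOf θ γ (t + 1) (omega θ γ (t + 1))) x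
  else fun _ => 0
termination_by M.T - t
decreasing_by omega

/-- `ω̄_t`. -/
def omegaBar (θ : ℝ) (γ : ℕ → ℝ) (t : ℕ) : ℝ → ℝ := M.omegaBarOf θ γ t (M.omega θ γ t)

end

end InventorySystem

namespace InventorySystem

noncomputable section

/-! The discretized recursion is an exact inventory recursion for the demand rounded down to the
lower end of its cell `(z_n, z_{n+1}]`: the sums weighted by `f_t(n)` are expectations of functions
of `lowDemand`. On the grid Scarf's argument therefore applies. `K`-convexity passes through
expectations and through `(s, S)` policies, and the search intervals are wide enough for the
computed `S_t`, `s_t` to be optimal among all grid points (`gridPolicy`, `gridValue`).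

The error then travels backward in two half steps. For `H_t` (`H_sub_Hstar_le`), split `V_{t+1}(x -
lowDemand) - V*_{t+1}(x - D_t)` at `V_{t+1}(x - D_t)`. The first part is a rise of `V_{t+1}` over a
distance at most `θ`, bounded by `φ_{t+1}(θ, ·)`; the second is the previous error, bounded by
`ω̄_{t+1}`.

For `V_t` (`V_sub_Vstar_le`), `V*_t` is an infimum over decisions. Not ordering, and ordering up to
some `y ≤ S^U_t`, are compared with grid decisions by rounding `x` and `y` down; an order beyond
`S^U_t` can be replaced by a smaller one or by none. Rounding both points seems to cost two errors
per period, but convexity makes the `C_t` parts compensate each other, so `cell_increment` pays `γ_t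
θ` only once. The resulting bound `dropBound` lies below `ψ̄_t(θ, ·)`, which produces `η_t`. -/

theorem backward_induction {N : ℕ} {p : ℕ → Prop} (last : ∀ t, t + 1 = N → p t)
    (step : ∀ t, t + 1 < N → p (t + 1) → p t) : ∀ t < N, p t := by
  intro t ht
  obtain ⟨k, hk⟩ : ∃ k, N = t + 1 + k := ⟨N - (t + 1), by omega⟩
  induction k generalizing t with
  | zero => exact last t (by omega)
  | succ k ih => exact step t (by omega) (ih (t + 1) (by omega) (by omega))

/-! ### Grid points -/

theorem z_add_one (θ : ℝ) (m : ℤ) : z θ (m + 1) = z θ m + θ := by simp [z]; ring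

theorem z_sub (θ : ℝ) (m n : ℤ) : z θ m - z θ n = z θ (m - n) := by simp [z]; ring

theorem z_le {θ : ℝ} (hθ : 0 < θ) {m n : ℤ} : z θ m ≤ z θ n ↔ m ≤ n := by
  simp [z, hθ]

theorem z_lt {θ : ℝ} (hθ : 0 < θ) {m n : ℤ} : z θ m < z θ n ↔ m < n := by
  simp [z, hθ]

/-- The set of grid points. -/
def grid (θ : ℝ) : Set ℝ := Set.range (z θ)

theorem sub_mem_grid {θ x : ℝ} (hx : x ∈ grid θ) (n : ℤ) : x - z θ n ∈ grid θ := by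
  obtain ⟨m, rfl⟩ := hx
  exact ⟨m - n, (z_sub θ m n).symm⟩

theorem grid_lt_iff {θ x y : ℝ} (hθ : 0 < θ) (hx : x ∈ grid θ) (hy : y ∈ grid θ) :
    x < y ↔ x ≤ y - θ := by
  obtain ⟨m, rfl⟩ := hx
  obtain ⟨n, rfl⟩ := hy
  have : z θ n - θ = z θ (n - 1) := by simp [z]; ring
  rw [this, z_lt hθ, z_le hθ]; omega

theorem isLeast_sInf_grid {θ : ℝ} (hθ : 0 < θ) {A : Set ℝ} (hA : A ⊆ grid θ) (hne : A.Nonempty)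
    (hb : BddBelow A) : IsLeast A (sInf A) := by
  obtain ⟨b, hb⟩ := hb
  obtain ⟨w, hw⟩ := hne
  obtain ⟨m, rfl⟩ := hA hw
  obtain ⟨l, hl, hl'⟩ := Int.exists_least_of_bdd (P := fun n => z θ n ∈ A)
    ⟨⌊b / θ⌋, fun n hn => by
      have h1 := hb hn
      have h2 : b / θ ≤ n := by rw [div_le_iff₀ hθ]; exact h1
      exact_mod_cast (Int.floor_le _).trans h2⟩ ⟨m, hw⟩
  have : IsLeast A (z θ l) := ⟨hl, fun y hy => by
    obtain ⟨n, rfl⟩ := hA hy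
    exact (z_le hθ).2 (hl' n hy)⟩
  rwa [this.csInf_eq]

theorem isGreatest_sSup_grid {θ : ℝ} (hθ : 0 < θ) {A : Set ℝ} (hA : A ⊆ grid θ) (hne : A.Nonempty)
    (hb : BddAbove A) : IsGreatest A (sSup A) := by
  obtain ⟨b, hb⟩ := hb
  obtain ⟨w, hw⟩ := hne
  obtain ⟨m, rfl⟩ := hA hw
  obtain ⟨l, hl, hl'⟩ := Int.exists_greatest_of_bdd (P := fun n => z θ n ∈ A)
    ⟨⌈b / θ⌉, fun n hn => by
      have h1 := hb hn
      have h2 : (n : ℝ) ≤ b / θ := by rw [le_div_iff₀ hθ]; exact h1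
      exact_mod_cast h2.trans (Int.le_ceil _)⟩ ⟨m, hw⟩
  have : IsGreatest A (z θ l) := ⟨hl, fun y hy => by
    obtain ⟨n, rfl⟩ := hA hy
    exact (z_le hθ).2 (hl' n hy)⟩
  rwa [this.csSup_eq]

theorem tendsto_z_atTop {θ : ℝ} (hθ : 0 < θ) : Tendsto (z θ) atTop atTop :=
  (tendsto_intCast_atTop_atTop (R := ℝ)).atTop_mul_const hθ

theorem tendsto_z_atBot {θ : ℝ} (hθ : 0 < θ) : Tendsto (z θ) atBot atBot :=
  Tendsto.atBot_mul_const hθ (tendsto_intCast_atBot_iff.2 tendsto_id)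

/-- The largest grid point `≤ x`. -/
def gridFloor (θ x : ℝ) : ℝ := z θ ⌊x / θ⌋

theorem gridFloor_mem (θ x : ℝ) : gridFloor θ x ∈ grid θ := ⟨_, rfl⟩

theorem gridFloor_le {θ : ℝ} (hθ : 0 < θ) (x : ℝ) : gridFloor θ x ≤ x :=
  (le_div_iff₀ hθ).1 (Int.floor_le (x / θ))

theorem lt_gridFloor_add {θ : ℝ} (hθ : 0 < θ) (x : ℝ) : x < gridFloor θ x + θ := by
  have := (div_lt_iff₀ hθ).1 (Int.lt_floor_add_one (x / θ))
  simp only [gridFloor, z]; linarith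

theorem gridFloor_mono {θ : ℝ} (hθ : 0 < θ) {x y : ℝ} (h : x ≤ y) :
    gridFloor θ x ≤ gridFloor θ y :=
  (z_le hθ).2 (Int.floor_le_floor (div_le_div_of_nonneg_right h hθ.le))

theorem le_gridFloor_iff {θ : ℝ} (hθ : 0 < θ) {x y : ℝ} (hx : x ∈ grid θ) :
    x ≤ gridFloor θ y ↔ x ≤ y := by
  obtain ⟨m, rfl⟩ := hx
  rw [gridFloor, z_le hθ, Int.le_floor, le_div_iff₀ hθ]; rfl

theorem gridFloor_of_mem {θ : ℝ} (hθ : 0 < θ) {x : ℝ} (hx : x ∈ grid θ) : gridFloor θ x = x :=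
  le_antisymm (gridFloor_le hθ x) ((le_gridFloor_iff hθ hx).2 le_rfl)

theorem gridFloor_sub {θ : ℝ} (hθ : 0 < θ) (x : ℝ) (n : ℤ) :
    gridFloor θ (x - z θ n) = gridFloor θ x - z θ n := by
  have : (x - z θ n) / θ = x / θ - n := by simp only [z]; field_simp
  rw [gridFloor, this, Int.floor_sub_intCast, gridFloor, z_sub]

/-! ### Convex functions -/

theorem antitone_left_of_min {g : ℝ → ℝ} (hg : ConvexOn ℝ Set.univ g) {a x y : ℝ}
    (ha : ∀ w, g a ≤ g w) (hxy : x ≤ y) (hya : y ≤ a) : g y ≤ g x := by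
  have := hg.le_max_of_mem_Icc (Set.mem_univ x) (Set.mem_univ a) ⟨hxy, hya⟩
  rwa [max_eq_left (ha x)] at this

theorem monotone_right_of_min {g : ℝ → ℝ} (hg : ConvexOn ℝ Set.univ g) {a x y : ℝ}
    (ha : ∀ w, g a ≤ g w) (hax : a ≤ x) (hxy : x ≤ y) : g x ≤ g y := by
  have := hg.le_max_of_mem_Icc (Set.mem_univ a) (Set.mem_univ y) ⟨hax, hxy⟩
  rwa [max_eq_right (ha y)] at this

theorem convex_three_point {g : ℝ → ℝ} (hg : ConvexOn ℝ Set.univ g) {a b c : ℝ}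
    (hab : a ≤ b) (hbc : b ≤ c) : (c - a) * g b ≤ (c - b) * g a + (b - a) * g c := by
  rcases (hab.trans hbc).eq_or_lt with h | h
  · obtain rfl : a = b := le_antisymm hab (h ▸ hbc)
    subst h; simp
  have hp : 0 < c - a := sub_pos.2 h
  have hb1 : 0 ≤ (c - b) / (c - a) := div_nonneg (by linarith) hp.le
  have hb2 : 0 ≤ (b - a) / (c - a) := div_nonneg (by linarith) hp.le
  have := hg.2 (Set.mem_univ a) (Set.mem_univ c) hb1 hb2 (by field_simp; ring)
  have e : ((c - b) / (c - a)) • a + ((b - a) / (c - a)) • c = b := by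
    simp only [smul_eq_mul]; field_simp; ring
  rw [e] at this
  simp only [smul_eq_mul] at this
  calc (c - a) * g b ≤ (c - a) * ((c - b) / (c - a) * g a + (b - a) / (c - a) * g c) :=
        mul_le_mul_of_nonneg_left this hp.le
    _ = _ := by field_simp

theorem convex_increment_le {g : ℝ → ℝ} (hg : ConvexOn ℝ Set.univ g) {p q ρ : ℝ}
    (hpq : p ≤ q) (hρ : 0 ≤ ρ) : g (p + ρ) - g p ≤ g (q + ρ) - g q := by
  rcases (add_nonneg (sub_nonneg.2 hpq) hρ).eq_or_lt with h | h
  · have h1 : ρ = 0 := by linarith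
    simp [h1]
  · have h1 := convex_three_point hg (a := p) (b := p + ρ) (c := q + ρ) (by linarith) (by linarith)
    have h2 := convex_three_point hg (a := p) (b := q) (c := q + ρ) (by linarith) (by linarith)
    have : (q - p + ρ) * (g (p + ρ) + g q) ≤ (q - p + ρ) * (g p + g (q + ρ)) := by nlinarith
    linarith [le_of_mul_le_mul_left this h]

/-- By convexity the increment over `ρ` only grows when moved from `p` to `q`. What remains is `g (q
+ ρ) - g (q + σ)`, at two points at distance at most `θ`: hence one `κ * θ` instead of two. -/
theorem convex_lipschitz_increment {g : ℝ → ℝ} (hg : ConvexOn ℝ Set.univ g) {κ θ p q ρ σ : ℝ}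
    (hκ : 0 ≤ κ) (hl : ∀ x y, |g x - g y| ≤ κ * |x - y|) (hpq : p ≤ q) (hρ : 0 ≤ ρ) (hρ' : ρ ≤ θ)
    (hσ : 0 ≤ σ) (hσ' : σ ≤ θ) : g (p + ρ) - g p + g q - g (q + σ) ≤ κ * θ := by
  have h1 := convex_increment_le hg hpq hρ
  have h2 := (le_abs_self _).trans (hl (q + ρ) (q + σ))
  have h3 : |q + ρ - (q + σ)| ≤ θ := abs_le.2 ⟨by linarith, by linarith⟩
  nlinarith [mul_le_mul_of_nonneg_left h3 hκ]

/-! ### `K`-convexity -/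

/-- `K`-convexity of `g` along the points of `A`. -/
def KConvexOn (A : Set ℝ) (K : ℝ) (g : ℝ → ℝ) : Prop :=
  ∀ ⦃a⦄, a ∈ A → ∀ ⦃b⦄, b ∈ A → ∀ ⦃c⦄, c ∈ A → a ≤ b → b ≤ c →
    (c - a) * g b ≤ (c - b) * g a + (b - a) * (g c + K)

theorem KConvexOn.mono {A B : Set ℝ} {K : ℝ} {g : ℝ → ℝ} (h : KConvexOn B K g) (hAB : A ⊆ B) :
    KConvexOn A K g := fun _ ha _ hb _ hc => h (hAB ha) (hAB hb) (hAB hc)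

theorem _root_.ConvexOn.kConvexOn {g : ℝ → ℝ} (hg : ConvexOn ℝ Set.univ g) {K : ℝ} (hK : 0 ≤ K)
    (A : Set ℝ) : KConvexOn A K g := fun a _ b _ c _ hab hbc => by
  have := convex_three_point hg hab hbc
  nlinarith [mul_nonneg (sub_nonneg.2 hab) hK]

/-- To the right of a point `s` with `g s ≤ m + K`, where `m` is a lower bound of `g`, the cost `K`
never pays for an increase of the argument. -/
theorem KConvexOn.le_add {A : Set ℝ} {K m s : ℝ} {g : ℝ → ℝ} (h : KConvexOn A K g) (hK : 0 ≤ K)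
    (hs : s ∈ A) (hgs : g s ≤ m + K) {b c : ℝ} (hb : b ∈ A) (hc : c ∈ A) (hm : m ≤ g c)
    (hsb : s ≤ b) (hbc : b ≤ c) : g b ≤ g c + K := by
  rcases (hsb.trans hbc).eq_or_lt with e | e
  · obtain rfl : b = c := le_antisymm hbc (e ▸ hsb)
    linarith
  · have h1 := h hs hb hc hsb hbc
    have h2 : (c - b) * g s ≤ (c - b) * (g c + K) :=
      mul_le_mul_of_nonneg_left (by linarith) (by linarith)
    have : (c - s) * g b ≤ (c - s) * (g c + K) := by nlinarith
    exact le_of_mul_le_mul_left this (by linarith)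

/-- The value function of an `(s, S)` policy inherits `K`-convexity. -/
theorem KConvexOn.policy {A : Set ℝ} {K m s : ℝ} {g : ℝ → ℝ} (h : KConvexOn A K g) (hK : 0 ≤ K)
    (hs : s ∈ A) (hgs : g s ≤ m + K) (hm : ∀ c ∈ A, m ≤ g c) :
    KConvexOn A K (fun y => if y < s then m + K else g y) := by
  intro a ha b hb c hc hab hbc
  have hmc := hm c hc
  simp only
  by_cases hbs : b < s
  · rw [if_pos hbs, if_pos (hab.trans_lt hbs)]
    have : m ≤ if c < s then m + K else g c := by split_ifs <;> linarith
    nlinarith [mul_le_mul_of_nonneg_left this (sub_nonneg.2 hab)]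
  · have hsb := not_lt.1 hbs
    rw [if_neg hbs, if_neg (not_lt.2 (hsb.trans hbc))]
    by_cases has : a < s
    · rw [if_pos has]
      by_cases hgb : g b ≤ m + K
      · nlinarith [mul_le_mul_of_nonneg_left hgb (by linarith : 0 ≤ c - a),
          mul_le_mul_of_nonneg_left hmc (sub_nonneg.2 hab)]
      -- Write `b - a` as `(b - s) + (s - a)`: `K`-convexity on `s, b, c` accounts for the first
      -- part, `h2` for the second.
      · have h1 := h hs hb hc hsb hbc
        have h2 := h.le_add hK hs hgs hb hc hmc hsb hbc
        nlinarith [mul_nonneg (sub_nonneg.2 has.le) (sub_nonneg.2 h2),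
          mul_le_mul_of_nonneg_left hgs (sub_nonneg.2 hbc)]
    · rw [if_neg has]
      exact h ha hb hc hab hbc

theorem KConvexOn.policy_le_add {A : Set ℝ} {K m s : ℝ} {g : ℝ → ℝ} (h : KConvexOn A K g)
    (hK : 0 ≤ K) (hs : s ∈ A) (hgs : g s ≤ m + K) (hm : ∀ c ∈ A, m ≤ g c) {b c : ℝ} (hb : b ∈ A)
    (hc : c ∈ A) (hbc : b ≤ c) :
    (if b < s then m + K else g b) ≤ (if c < s then m + K else g c) + K := by
  have hmc := hm c hc
  by_cases hbs : b < s
  · rw [if_pos hbs]; split_ifs <;> linarith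
  · rw [if_neg hbs, if_neg (not_lt.2 ((not_lt.1 hbs).trans hbc))]
    exact h.le_add hK hs hgs hb hc hmc (not_lt.1 hbs) hbc

/-! ### Rounding the demand down to the grid -/

section

variable {Ω : Type*} [MeasurableSpace Ω] {P : Measure Ω} (M : InventorySystem P)

/-- The index `n` of the cell `(z_n, z_{n+1}]` that contains the demand. -/
def cell (θ : ℝ) (t : ℕ) (ω : Ω) : ℤ := ⌈M.D t ω / θ⌉ - 1

/-- The demand, rounded down to the lower end point of its cell. -/
def lowDemand (θ : ℝ) (t : ℕ) (ω : Ω) : ℝ := z θ (M.cell θ t ω)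

theorem cell_eq_iff {θ : ℝ} (hθ : 0 < θ) {t : ℕ} {ω : Ω} {n : ℤ} :
    M.cell θ t ω = n ↔ M.D t ω ∈ Set.Ioc (z θ n) (z θ (n + 1)) := by
  rw [cell, sub_eq_iff_eq_add, Int.ceil_eq_iff, lt_div_iff₀ hθ, div_le_iff₀ hθ, Set.mem_Ioc]
  simp [z]

theorem lowDemand_lt {θ : ℝ} (hθ : 0 < θ) (t : ℕ) (ω : Ω) : M.lowDemand θ t ω < M.D t ω :=
  ((M.cell_eq_iff hθ).1 rfl).1

theorem le_lowDemand_add {θ : ℝ} (hθ : 0 < θ) (t : ℕ) (ω : Ω) :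
    M.D t ω ≤ M.lowDemand θ t ω + θ := by
  have := ((M.cell_eq_iff (θ := θ) hθ (t := t) (ω := ω)).1 rfl).2
  rwa [z_add_one] at this

/-- Cells are open on the left, so zero demand lies in `(-θ, 0]`, the cell of index `-1`. The
rounded demand can thus equal `-θ`. -/
theorem cell_ge {θ : ℝ} (hθ : 0 < θ) {t : ℕ} (ht : t < M.T) : ∀ᵐ ω ∂P, -1 ≤ M.cell θ t ω := by
  filter_upwards [M.D_nonneg t ht] with ω hω
  have : (0 : ℤ) ≤ ⌈M.D t ω / θ⌉ := Int.ceil_nonneg (div_nonneg hω hθ.le)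
  rw [cell]; omega

theorem neg_le_lowDemand {θ : ℝ} (hθ : 0 < θ) {t : ℕ} (ht : t < M.T) :
    ∀ᵐ ω ∂P, -θ ≤ M.lowDemand θ t ω := by
  filter_upwards [M.cell_ge hθ ht] with ω hω
  have := (z_le hθ).2 hω
  simpa [z, lowDemand] using this

theorem measurable_cell (θ : ℝ) {t : ℕ} (ht : t < M.T) : Measurable (M.cell θ t) :=
  (Int.measurable_ceil.comp ((M.D_measurable t ht).div_const θ)).sub_const 1

theorem map_cell_singleton [IsProbabilityMeasure P] {θ : ℝ} (hθ : 0 < θ) {t : ℕ} (ht : t < M.T)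
    (n : ℤ) : (P.map (M.cell θ t)).real {n} = M.f θ t n := by
  have : IsProbabilityMeasure (P.map (M.D t)) :=
    Measure.isProbabilityMeasure_map (M.D_measurable t ht).aemeasurable
  have h1 : M.cell θ t ⁻¹' {n} = M.D t ⁻¹' Set.Ioc (z θ n) (z θ (n + 1)) := by
    ext ω; exact M.cell_eq_iff hθ
  have h2 : (P.map (M.D t)) (Set.Ioc (z θ n) (z θ (n + 1))) = ENNReal.ofReal (M.f θ t n) := by
    rw [← measure_cdf (P.map (M.D t)), StieltjesFunction.measure_Ioc]; rfl
  rw [measureReal_def, Measure.map_apply (M.measurable_cell θ ht) (measurableSet_singleton n), h1,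
    ← Measure.map_apply (M.D_measurable t ht) measurableSet_Ioc, h2, ENNReal.toReal_ofReal]
  rw [f, sub_nonneg]
  exact monotone_cdf _ ((z_le hθ).2 (by omega))

theorem f_eq_zero [IsProbabilityMeasure P] {θ : ℝ} (hθ : 0 < θ) {t : ℕ} (ht : t < M.T)
    {n : ℤ} (hn : n < -1) : M.f θ t n = 0 := by
  rw [← M.map_cell_singleton hθ ht, measureReal_def,
    Measure.map_apply (M.measurable_cell θ ht) (measurableSet_singleton n)]
  have : P (M.cell θ t ⁻¹' {n}) = 0 := by
    rw [measure_eq_zero_iff_ae_notMem]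
    filter_upwards [M.cell_ge hθ ht] with ω hω
    simp only [Set.mem_preimage, Set.mem_singleton_iff]; omega
  rw [this, ENNReal.toReal_zero]

/-- `g` is constant near `-∞`. -/
def TailConst (g : ℝ → ℝ) : Prop := ∃ b c, ∀ x < b, g x = c

/-- No regularity of `g` is needed. The integrand factors through the integer `cell`, hence is
measurable, and only finitely many cells from `-1` on precede the constant tail, hence it is almost
surely bounded. -/
theorem TailConst.integrable [IsProbabilityMeasure P] {g : ℝ → ℝ} (hg : TailConst g) {θ : ℝ}
    (hθ : 0 < θ) {t : ℕ} (ht : t < M.T) (x : ℝ) :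
    Integrable (fun ω => g (x - M.lowDemand θ t ω)) P := by
  obtain ⟨b, c, hbc⟩ := hg
  have hm : Measurable (fun ω => g (x - M.lowDemand θ t ω)) :=
    (measurable_from_top (f := fun n : ℤ => g (x - z θ n))).comp (M.measurable_cell θ ht)
  refine Integrable.of_bound hm.aestronglyMeasurable
    (|c| + ∑ n ∈ Finset.Icc (-1 : ℤ) ⌈(x - b) / θ⌉, |g (x - z θ n)|) ?_
  filter_upwards [M.cell_ge hθ ht] with ω hω
  rw [Real.norm_eq_abs]
  by_cases h : M.cell θ t ω ≤ ⌈(x - b) / θ⌉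
  · have := Finset.single_le_sum (f := fun n : ℤ => |g (x - z θ n)|) (fun _ _ => abs_nonneg _)
      (Finset.mem_Icc.2 ⟨hω, h⟩)
    have h2 := abs_nonneg c
    simp only [lowDemand]
    linarith
  · have h1 : (x - b) / θ < M.cell θ t ω := by
      push Not at h
      exact (Int.le_ceil _).trans_lt (by exact_mod_cast h)
    rw [div_lt_iff₀ hθ] at h1
    rw [hbc _ (by simp only [lowDemand, z]; linarith)]
    have : 0 ≤ ∑ n ∈ Finset.Icc (-1 : ℤ) ⌈(x - b) / θ⌉, |g (x - z θ n)| :=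
      Finset.sum_nonneg fun _ _ => abs_nonneg _
    linarith

theorem TailConst.integral_eq_tsum [IsProbabilityMeasure P] {g : ℝ → ℝ} (hg : TailConst g)
    {θ : ℝ} (hθ : 0 < θ) {t : ℕ} (ht : t < M.T) (x : ℝ) :
    ∫ ω, g (x - M.lowDemand θ t ω) ∂P = ∑' n : ℤ, g (x - z θ n) * M.f θ t n := by
  have hc := (M.measurable_cell θ ht).aemeasurable (μ := P)
  have hi : Integrable (fun n : ℤ => g (x - z θ n)) (P.map (M.cell θ t)) :=
    (integrable_map_measure measurable_from_top.aestronglyMeasurable hc).2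
      (hg.integrable M hθ ht x)
  have := integral_map hc (f := fun n : ℤ => g (x - z θ n))
    measurable_from_top.aestronglyMeasurable
  rw [integral_countable hi] at this
  simp only [lowDemand]
  rw [← this]
  exact tsum_congr fun n => by rw [M.map_cell_singleton hθ ht, smul_eq_mul, mul_comm]

theorem TailConst.discExp_eq [IsProbabilityMeasure P] {g : ℝ → ℝ} (hg : TailConst g)
    {θ : ℝ} (hθ : 0 < θ) {t : ℕ} (ht : t < M.T) (x : ℝ) :
    M.discExp θ t g x = ∫ ω, g (x - M.lowDemand θ t ω) ∂P := by
  rw [hg.integral_eq_tsum M hθ ht, discExp]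
  have hinj : Function.Injective (fun k : ℕ => (k : ℤ) - 1) := fun a b h => by
    simpa using h
  refine hinj.tsum_eq (f := fun n : ℤ => g (x - z θ n) * M.f θ t n) fun n hn => ?_
  by_cases h : n < -1
  · simp [M.f_eq_zero hθ ht h] at hn
  · exact ⟨(n + 1).toNat, by simp only; omega⟩

/-- The terms beyond the floor vanish, so the finite sums defining `ψ_t` and `ψ̄_t` are full
expectations. -/
theorem sum_Icc_eq_integral [IsProbabilityMeasure P] {g : ℝ → ℝ} {b : ℝ} (hg : ∀ x < b, g x = 0)
    {θ : ℝ} (hθ : 0 < θ) {t : ℕ} (ht : t < M.T) (x : ℝ) :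
    ∑ m ∈ Finset.Icc (-1 : ℤ) ⌊(x - b) / θ⌋, g (x - z θ m) * M.f θ t m
      = ∫ ω, g (x - M.lowDemand θ t ω) ∂P := by
  rw [TailConst.integral_eq_tsum M ⟨b, 0, hg⟩ hθ ht, tsum_eq_sum]
  intro n hn
  by_cases h : n < -1
  · simp [M.f_eq_zero hθ ht h]
  · have h1 : (x - b) / θ < n := by
      rw [Finset.mem_Icc] at hn
      exact Int.floor_lt.1 (by omega)
    rw [div_lt_iff₀ hθ] at h1
    rw [hg _ (by simp only [z]; linarith), zero_mul]

end

variable {Ω : Type*} [MeasurableSpace Ω] {P : Measure Ω} {M : InventorySystem P}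

/-- The standing assumptions on the one-period costs, the setup costs and the mesh. -/
structure Admissible (M : InventorySystem P) (γ : ℕ → ℝ) (θ : ℝ) : Prop where
  convex : ∀ t < M.T, ConvexOn ℝ Set.univ (M.C t)
  tendsto_atTop : ∀ t < M.T, Tendsto (M.C t) atTop atTop
  tendsto_atBot : ∀ t < M.T, Tendsto (M.C t) atBot atTop
  K_le : ∀ t, t + 1 < M.T → M.α * M.K (t + 1) ≤ M.K t
  γ_nonneg : ∀ t < M.T, 0 ≤ γ t
  lip : ∀ t < M.T, ∀ x y : ℝ, |M.C t x - M.C t y| ≤ γ t * |x - y|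
  θ_pos : 0 < θ

variable {γ : ℕ → ℝ} {θ : ℝ}

/-! ### Minimizer and monotonicity of the one-period cost -/

theorem Admissible.continuous (A : Admissible M γ θ) {t : ℕ} (ht : t < M.T) :
    Continuous (M.C t) :=
  (LipschitzWith.of_dist_le' (K := γ t) (A.lip t ht)).continuous

theorem Admissible.isLeast_Cm (A : Admissible M γ θ) {t : ℕ} (ht : t < M.T) :
    IsLeast {y | ∀ x, M.C t y ≤ M.C t x} (M.Cm t) := by
  have hcoc : Tendsto (M.C t) (cocompact ℝ) atTop := by
    rw [cocompact_eq_atBot_atTop]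
    exact (A.tendsto_atBot t ht).sup (A.tendsto_atTop t ht)
  have hne : {y | ∀ x, M.C t y ≤ M.C t x}.Nonempty :=
    (A.continuous ht).exists_forall_le hcoc
  refine IsClosed.isLeast_csInf ?_ hne ?_
  · rw [Set.ofPred_forall]
    exact isClosed_iInter fun x => isClosed_le (A.continuous ht) continuous_const
  · obtain ⟨b, hb⟩ := eventually_atBot.1
      ((A.tendsto_atBot t ht).eventually (eventually_gt_atTop (M.C t 0)))
    refine ⟨b, fun y hy => le_of_not_gt fun h => ?_⟩
    exact absurd (hb y h.le) (not_lt.2 (hy 0))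

theorem Admissible.C_Cm_le (A : Admissible M γ θ) {t : ℕ} (ht : t < M.T) (x : ℝ) :
    M.C t (M.Cm t) ≤ M.C t x := (A.isLeast_Cm ht).1 x

theorem Admissible.C_anti (A : Admissible M γ θ) {t : ℕ} (ht : t < M.T) {x y : ℝ}
    (hxy : x ≤ y) (hy : y ≤ M.Cm t) : M.C t y ≤ M.C t x :=
  antitone_left_of_min (A.convex t ht) (A.C_Cm_le ht) hxy hy

theorem Admissible.C_mono (A : Admissible M γ θ) {t : ℕ} (ht : t < M.T) {x y : ℝ}
    (hx : M.Cm t ≤ x) (hxy : x ≤ y) : M.C t x ≤ M.C t y :=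
  monotone_right_of_min (A.convex t ht) (A.C_Cm_le ht) hx hxy

/-! ### The optimal costs -/

theorem delta_nonneg (x : ℝ) : 0 ≤ delta x := by unfold delta; split_ifs <;> norm_num

theorem delta_le_one (x : ℝ) : delta x ≤ 1 := by unfold delta; split_ifs <;> norm_num

theorem Vstar_last (x : ℝ) : M.Vstar M.T x = 0 := by
  rw [Vstar, v]; simp

/-- Lipschitz continuous and bounded below. -/
def LipBelow (g : ℝ → ℝ) : Prop :=
  (∃ L, 0 ≤ L ∧ ∀ x y, |g x - g y| ≤ L * |x - y|) ∧ ∃ B, ∀ x, B ≤ g x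

theorem LipBelow.continuous {g : ℝ → ℝ} (hg : LipBelow g) : Continuous g := by
  obtain ⟨⟨L, -, h⟩, -⟩ := hg
  exact (LipschitzWith.of_dist_le' (K := L) h).continuous

theorem LipBelow.integrable [IsProbabilityMeasure P] {g : ℝ → ℝ} (hg : LipBelow g) {t : ℕ}
    (ht : t < M.T) (x : ℝ) : Integrable (fun ω => g (x - M.D t ω)) P := by
  have hc := hg.continuous
  obtain ⟨⟨L, hL, h⟩, -⟩ := hg
  have hi : Integrable (fun ω => |g x| + L * |M.D t ω|) P :=
    (integrable_const _).add ((M.D_integrable t ht).abs.const_mul L)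
  refine hi.mono' (hc.measurable.comp
    (measurable_const.sub (M.D_measurable t ht))).aestronglyMeasurable
    (Eventually.of_forall fun ω => ?_)
  have h1 := h (x - M.D t ω) x
  rw [show x - M.D t ω - x = -M.D t ω by ring, abs_neg] at h1
  rw [Real.norm_eq_abs]
  have h2 := abs_sub_abs_le_abs_sub (g (x - M.D t ω)) (g x)
  linarith

theorem Admissible.Hstar_lipBelow [IsProbabilityMeasure P] (A : Admissible M γ θ) {t : ℕ}
    (ht : t < M.T) (hV : LipBelow (M.Vstar (t + 1))) : LipBelow (M.Hstar t) := by
  have hi := fun x => hV.integrable (M := M) ht x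
  obtain ⟨⟨L, hL, h⟩, B, hB⟩ := hV
  have hα := M.α_pos
  refine ⟨⟨γ t + M.α * L, add_nonneg (A.γ_nonneg t ht) (mul_nonneg hα.le hL), fun x y => ?_⟩,
    M.C t (M.Cm t) + M.α * B, fun x => ?_⟩
  · have h1 : |∫ ω, M.Vstar (t + 1) (x - M.D t ω) ∂P - ∫ ω, M.Vstar (t + 1) (y - M.D t ω) ∂P|
        ≤ L * |x - y| := by
      rw [← integral_sub (hi x) (hi y), ← Real.norm_eq_abs]
      refine (norm_integral_le_of_norm_le_const (C := L * |x - y|)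
        (Eventually.of_forall fun ω => ?_)).trans (by simp)
      have := h (x - M.D t ω) (y - M.D t ω)
      rwa [sub_sub_sub_cancel_right] at this
    have h2 := A.lip t ht x y
    rw [Hstar, Hstar, show ∀ a b c d : ℝ, a + M.α * b - (c + M.α * d) = (a - c) + M.α * (b - d) by
      intros; ring]
    refine (abs_add_le _ _).trans ?_
    rw [abs_mul, abs_of_pos hα]
    nlinarith
  · have h1 : B ≤ ∫ ω, M.Vstar (t + 1) (x - M.D t ω) ∂P := by
      have := integral_mono (integrable_const (μ := P) B) (hi x) fun ω => hB _
      simpa using this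
    rw [Hstar]
    have := A.C_Cm_le ht x
    nlinarith

theorem bddBelow_order_cost {g : ℝ → ℝ} (hg : ∃ B, ∀ x, B ≤ g x) {K : ℝ} (hK : 0 ≤ K) (x : ℝ) :
    BddBelow (Set.range fun y : Set.Ici x => K * delta ((y : ℝ) - x) + g y) := by
  obtain ⟨B, hB⟩ := hg
  refine ⟨B, ?_⟩
  rintro _ ⟨y, rfl⟩
  have := mul_nonneg hK (delta_nonneg ((y : ℝ) - x))
  have := hB y
  simp only; linarith

/-- The linear purchase costs telescope into `C_t`, leaving only the setup cost. The Lipschitz bound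
gives the integrability needed to split the expectation; the lower bound makes the real infimum a
genuine one. -/
theorem Vstar_eq [IsProbabilityMeasure P] {t : ℕ} (ht : t < M.T)
    (hV : LipBelow (M.Vstar (t + 1))) (hH : ∃ B, ∀ x, B ≤ M.Hstar t x) (x : ℝ) :
    M.Vstar t x = ⨅ y : Set.Ici x, (M.K t * delta ((y : ℝ) - x) + M.Hstar t y) := by
  have key : ∀ y : ℝ, M.K t * delta (y - x) + M.c t * (y - x) + M.G t y
      + M.α * ∫ ω, M.v (t + 1) (y - M.D t ω) ∂P
      = M.K t * delta (y - x) + M.Hstar t y + -(M.c t * x) := by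
    intro y
    have h1 : ∫ ω, M.v (t + 1) (y - M.D t ω) ∂P = ∫ ω, M.Vstar (t + 1) (y - M.D t ω) ∂P
        - M.c (t + 1) * (y - ∫ ω, M.D t ω ∂P) := by
      have h2 : ∀ ω, M.v (t + 1) (y - M.D t ω)
          = M.Vstar (t + 1) (y - M.D t ω) - M.c (t + 1) * (y - M.D t ω) := fun ω => by
        rw [Vstar]; ring
      simp_rw [h2]
      have hD := M.D_integrable t ht
      have hi : Integrable (fun ω => y - M.D t ω) P := (integrable_const y).sub hD
      rw [integral_sub (hV.integrable ht y) (hi.const_mul _),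
        integral_const_mul, integral_sub (integrable_const y) hD]
      simp
    rw [h1, Hstar, C]; ring
  rw [Vstar, v]
  simp only [ht, dif_pos]
  simp_rw [key]
  rw [← ciInf_add (bddBelow_order_cost hH (M.K_nonneg t ht) x)]
  ring

theorem Admissible.Vstar_lipBelow [IsProbabilityMeasure P] (A : Admissible M γ θ) :
    ∀ t ≤ M.T, LipBelow (M.Vstar t) := by
  intro t ht
  -- The induction starts at `T` itself, where `V*_T = 0`.
  refine backward_induction (N := M.T + 1) (p := fun t => LipBelow (M.Vstar t))
    (fun t h => ?_) (fun t h ih => ?_) t (by omega)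
  · obtain rfl : t = M.T := by omega
    exact ⟨⟨0, le_rfl, fun x y => by simp [Vstar_last]⟩, 0, fun x => by simp [Vstar_last]⟩
  · have ht : t < M.T := by omega
    have hH := A.Hstar_lipBelow ht ih
    have hK := M.K_nonneg t ht
    have heq := Vstar_eq ht ih hH.2
    obtain ⟨⟨L, hL, hl⟩, hB⟩ := hH
    have half : ∀ x y, M.Vstar t x ≤ M.Vstar t y + L * |x - y| := by
      intro x y
      rw [heq x, heq y, ← sub_le_iff_le_add]
      refine le_ciInf fun w => ?_
      rw [sub_le_iff_le_add]
      -- From `x`, order the same quantity as from `y`: the setup cost is unchanged and only the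
      -- level reached is translated.
      have hw : x ≤ w + (x - y) := by have := w.2; simp only [Set.mem_Ici] at this; linarith
      refine (ciInf_le (bddBelow_order_cost hB hK x) ⟨w + (x - y), hw⟩).trans ?_
      have h1 := (abs_le.1 (hl (w + (x - y)) w)).2
      rw [add_sub_cancel_left] at h1
      simp only
      rw [show (w : ℝ) + (x - y) - x = w - y by ring]
      linarith
    refine ⟨⟨L, hL, fun x y => abs_le.2 ⟨?_, ?_⟩⟩, ?_⟩
    · have := half y x
      rw [abs_sub_comm] at this; linarith
    · linarith [half x y]
    · obtain ⟨B, hB⟩ := hB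
      refine ⟨B, fun x => ?_⟩
      rw [heq x]
      refine le_ciInf fun w => ?_
      have := mul_nonneg hK (delta_nonneg ((w : ℝ) - x))
      linarith [hB w]

theorem Admissible.le_Vstar [IsProbabilityMeasure P] (A : Admissible M γ θ) {t : ℕ} (ht : t < M.T)
    {x b : ℝ} (h : b ≤ M.Hstar t x) (h' : ∀ y, x ≤ y → b ≤ M.K t + M.Hstar t y) :
    b ≤ M.Vstar t x := by
  have hV := A.Vstar_lipBelow (t + 1) ht
  rw [Vstar_eq ht hV (A.Hstar_lipBelow ht hV).2]
  refine le_ciInf fun y => ?_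
  rcases (Set.mem_Ici.1 y.2).eq_or_lt with e | e
  · rw [← e]; simpa [delta] using h
  · have : delta ((y : ℝ) - x) = 1 := if_pos (sub_pos.2 e)
    rw [this, mul_one]
    exact h' y e.le

/-- Every level reachable from `y` is reachable from `x`, with at most one additional setup cost. -/
theorem Admissible.Vstar_le_add [IsProbabilityMeasure P] (A : Admissible M γ θ) {t : ℕ}
    (ht : t < M.T) {x y : ℝ} (hxy : x ≤ y) : M.Vstar t x ≤ M.Vstar t y + M.K t := by
  have hV := A.Vstar_lipBelow (t + 1) ht
  have hB := (A.Hstar_lipBelow ht hV).2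
  have hK := M.K_nonneg t ht
  rw [Vstar_eq ht hV hB, Vstar_eq ht hV hB, ← sub_le_iff_le_add]
  refine le_ciInf fun w => ?_
  rw [sub_le_iff_le_add]
  refine (ciInf_le (bddBelow_order_cost hB hK x) ⟨w, hxy.trans w.2⟩).trans ?_
  have h1 := mul_le_mul_of_nonneg_left (delta_le_one ((w : ℝ) - x)) hK
  have h2 := mul_nonneg hK (delta_nonneg ((w : ℝ) - y))
  simp only; linarith

/-- Raising the stock level lowers the optimal expected cost of the following periods by at most
the setup cost. -/
theorem Admissible.Hstar_sub_le [IsProbabilityMeasure P] (A : Admissible M γ θ) {t : ℕ}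
    (ht : t + 1 < M.T) {x y : ℝ} (hxy : x ≤ y) :
    M.Hstar t x ≤ M.Hstar t y + (M.C t x - M.C t y) + M.K t := by
  have hV := A.Vstar_lipBelow (t + 1) ht.le
  have h1 : ∫ ω, M.Vstar (t + 1) (x - M.D t ω) ∂P
      ≤ ∫ ω, (M.Vstar (t + 1) (y - M.D t ω) + M.K (t + 1)) ∂P :=
    integral_mono (hV.integrable (by omega) x)
      ((hV.integrable (by omega) y).add (integrable_const _)) fun ω =>
        A.Vstar_le_add ht (by linarith)
  rw [integral_add (hV.integrable (by omega) y) (integrable_const _)] at h1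
  simp only [integral_const, probReal_univ, one_smul] at h1
  have h2 := mul_le_mul_of_nonneg_left h1 M.α_pos.le
  have h3 := A.K_le t ht
  rw [Hstar, Hstar]
  nlinarith

theorem Hstar_last {t : ℕ} (ht : t + 1 = M.T) (x : ℝ) : M.Hstar t x = M.C t x := by
  rw [Hstar, ht]; simp [Vstar_last]

/-! ### The quantities of the discretized recursion -/

/-- The witness `w` is the last grid point below `C^m_t`; it replaces order-up-to levels beyond
`S^U_t`. -/
theorem Admissible.SU_spec (A : Admissible M γ θ) {t : ℕ} (ht : t < M.T) :
    M.SU θ t ∈ grid θ ∧ M.Cm t ≤ M.SU θ t ∧ ∃ w ∈ grid θ, w < M.Cm t ∧ M.Cm t ≤ w + θ ∧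
      M.C t w + M.K t < M.C t (M.SU θ t) := by
  have hθ := A.θ_pos
  have h := isLeast_sInf_grid hθ (A := {w | ∃ m n₀ : ℤ, w = z θ m ∧ z θ n₀ < M.Cm t ∧
    M.Cm t ≤ z θ (n₀ + 1) ∧ M.C t (z θ n₀) + M.K t < M.C t (z θ m) ∧ M.Cm t ≤ z θ m})
    (by rintro w ⟨m, n₀, rfl, -⟩; exact ⟨m, rfl⟩) ?_
    ⟨M.Cm t, by rintro w ⟨m, n₀, rfl, -, -, -, h⟩; exact h⟩
  · obtain ⟨m, n₀, h1, h2, h3, h4, h5⟩ := h.1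
    change M.SU θ t = _ at h1
    rw [h1]
    exact ⟨⟨m, rfl⟩, h5, z θ n₀, ⟨n₀, rfl⟩, h2, by rwa [← z_add_one], h4⟩
  · have h1 := ((A.tendsto_atTop t ht).comp (tendsto_z_atTop hθ)).eventually
      (eventually_gt_atTop (M.C t (z θ (⌈M.Cm t / θ⌉ - 1)) + M.K t))
    obtain ⟨m, hm, hm'⟩ :=
      (h1.and ((tendsto_z_atTop hθ).eventually (eventually_ge_atTop (M.Cm t)))).exists
    refine ⟨_, m, ⌈M.Cm t / θ⌉ - 1, rfl, ?_, ?_, hm, hm'⟩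
    · rw [z, ← lt_div_iff₀ hθ]
      push_cast
      linarith [Int.ceil_lt_add_one (M.Cm t / θ)]
    · rw [z, ← div_le_iff₀ hθ]
      push_cast
      linarith [Int.le_ceil (M.Cm t / θ)]

theorem Admissible.IOf_spec (A : Admissible M γ θ) (t : ℕ) (J : ℝ) :
    M.IOf θ t J ∈ grid θ ∧ M.IOf θ t J < J - θ ∧ M.IOf θ t J < M.Cm t := by
  have hθ := A.θ_pos
  have h := isGreatest_sSup_grid hθ (A := {w | ∃ m : ℤ, w = z θ m ∧
    z θ m < min (J - θ) (M.Cm t)}) (by rintro w ⟨m, rfl, -⟩; exact ⟨m, rfl⟩) ?_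
    ⟨min (J - θ) (M.Cm t), by rintro w ⟨m, rfl, h⟩; exact h.le⟩
  · obtain ⟨m, h1, h2⟩ := h.1
    change M.IOf θ t J = _ at h1
    rw [h1]
    exact ⟨⟨m, rfl⟩, lt_min_iff.1 h2⟩
  · obtain ⟨m, hm⟩ := ((tendsto_z_atBot hθ).eventually
      (eventually_lt_atBot (min (J - θ) (M.Cm t)))).exists
    exact ⟨_, m, rfl, hm⟩

theorem Admissible.I_mem (A : Admissible M γ θ) (t : ℕ) : M.I θ t ∈ grid θ := (A.IOf_spec t _).1

theorem Admissible.I_lt_Ibar (A : Admissible M γ θ) (t : ℕ) :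
    M.I θ t < M.Ibar θ (t + 1) - θ := (A.IOf_spec t _).2.1

theorem Admissible.I_lt_Cm (A : Admissible M γ θ) (t : ℕ) : M.I θ t < M.Cm t :=
  (A.IOf_spec t _).2.2

theorem Admissible.Ibar_spec (A : Admissible M γ θ) {t : ℕ} (ht : t + 1 < M.T) :
    M.Ibar θ t - θ ∈ grid θ ∧ M.C t (M.I θ t) + M.K t < M.C t (M.Ibar θ t - θ) ∧
      M.Ibar θ t ≤ M.I θ t := by
  have hθ := A.θ_pos
  have e : M.Ibar θ t - θ = sSup {w | ∃ m : ℤ, w = z θ m ∧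
      M.C t (M.I θ t) + M.K t < M.C t (z θ m) ∧ z θ m ≤ M.I θ t} := by
    rw [Ibar, dif_pos ht, add_sub_cancel_right]; rfl
  have h := isGreatest_sSup_grid hθ (A := {w | ∃ m : ℤ, w = z θ m ∧
      M.C t (M.I θ t) + M.K t < M.C t (z θ m) ∧ z θ m ≤ M.I θ t})
    (by rintro w ⟨m, rfl, -⟩; exact ⟨m, rfl⟩) ?_
    ⟨M.I θ t, by rintro w ⟨m, rfl, -, h⟩; exact h⟩
  · obtain ⟨m, h1, h2, h3⟩ := h.1
    rw [← e] at h1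
    rw [← h1] at h2 h3
    have hg : M.Ibar θ t - θ ∈ grid θ := ⟨m, h1.symm⟩
    refine ⟨hg, h2, ?_⟩
    have hK := M.K_nonneg t (by omega)
    have h4 : M.Ibar θ t - θ < M.I θ t := lt_of_le_of_ne h3 fun h5 => by
      rw [h5] at h2; linarith
    have := (grid_lt_iff hθ hg (A.I_mem t)).1 h4
    linarith
  · obtain ⟨m, hm, hm'⟩ :=
      ((((A.tendsto_atBot t (by omega)).comp (tendsto_z_atBot hθ)).eventually
        (eventually_gt_atTop (M.C t (M.I θ t) + M.K t))).and
        ((tendsto_z_atBot hθ).eventually (eventually_le_atBot (M.I θ t)))).exists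
    exact ⟨_, m, rfl, hm, hm'⟩

theorem Admissible.I_le_SU (A : Admissible M γ θ) {t : ℕ} (ht : t < M.T) :
    M.I θ t ≤ M.SU θ t := (A.I_lt_Cm t).le.trans (A.SU_spec ht).2.1

theorem Admissible.SOf_spec (A : Admissible M γ θ) {t : ℕ} (ht : t + 1 < M.T) (h : ℝ → ℝ) :
    M.SOf θ t h ∈ grid θ ∧ M.I θ t ≤ M.SOf θ t h ∧ M.SOf θ t h ≤ M.SU θ t ∧
      ∀ w ∈ grid θ, M.I θ t ≤ w → w ≤ M.SU θ t → h (M.SOf θ t h) ≤ h w := by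
  have hθ := A.θ_pos
  have e : M.SOf θ t h = sSup {w | ∃ m : ℤ, w = z θ m ∧ M.I θ t ≤ z θ m ∧ z θ m ≤ M.SU θ t ∧
      ∀ n : ℤ, M.I θ t ≤ z θ n → z θ n ≤ M.SU θ t → h (z θ m) ≤ h (z θ n)} := by
    rw [SOf, if_pos ht]
  have g := isGreatest_sSup_grid hθ (A := {w | ∃ m : ℤ, w = z θ m ∧ M.I θ t ≤ z θ m ∧
      z θ m ≤ M.SU θ t ∧
      ∀ n : ℤ, M.I θ t ≤ z θ n → z θ n ≤ M.SU θ t → h (z θ m) ≤ h (z θ n)})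
    (by rintro w ⟨m, rfl, -⟩; exact ⟨m, rfl⟩) ?_
    ⟨M.SU θ t, by rintro w ⟨m, rfl, -, h, -⟩; exact h⟩
  · obtain ⟨m, h1, h2, h3, h4⟩ := g.1
    rw [← e] at h1
    rw [h1]
    refine ⟨⟨m, rfl⟩, h2, h3, ?_⟩
    rintro _ ⟨n, rfl⟩ hn hn'
    exact h4 n hn hn'
  · obtain ⟨a, ha⟩ := A.I_mem t
    obtain ⟨b, hb⟩ := (A.SU_spec (t := t) (by omega)).1
    have hab := A.I_le_SU (t := t) (by omega)
    rw [← ha, ← hb, z_le hθ] at hab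
    obtain ⟨m, hm, hm'⟩ := Finset.exists_min_image (Finset.Icc a b) (fun n => h (z θ n))
      ⟨a, Finset.left_mem_Icc.2 hab⟩
    rw [Finset.mem_Icc] at hm
    refine ⟨_, m, rfl, ?_, ?_, fun n hn hn' => hm' n ?_⟩
    · rw [← ha]; exact (z_le hθ).2 hm.1
    · rw [← hb]; exact (z_le hθ).2 hm.2
    · rw [← ha, z_le hθ] at hn
      rw [← hb, z_le hθ] at hn'
      exact Finset.mem_Icc.2 ⟨hn, hn'⟩

theorem Admissible.Ibar_le_SOf (A : Admissible M γ θ) {t : ℕ} (ht : t + 1 < M.T) (h : ℝ → ℝ) :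
    M.Ibar θ t ≤ M.SOf θ t h := (A.Ibar_spec ht).2.2.trans (A.SOf_spec ht h).2.1

/-- The disjunction reflects the two definitions of `s_t`. For `K_t ≠ 0` minimality in the search
covers everything from `Ī_t` on; for `K_t = 0` one has `s_t = S_t` and only the optimality of `S_t`
on `[I_t, S^U_t]`. -/
theorem Admissible.sOf_spec (A : Admissible M γ θ) {t : ℕ} (ht : t + 1 < M.T) (h : ℝ → ℝ) :
    M.sOf θ t h ∈ grid θ ∧ M.sOf θ t h ≤ M.SOf θ t h ∧ M.Ibar θ t ≤ M.sOf θ t h ∧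
      h (M.sOf θ t h) ≤ h (M.SOf θ t h) + M.K t ∧
      ∀ w ∈ grid θ, M.I θ t ≤ w ∨ (M.K t ≠ 0 ∧ M.Ibar θ t ≤ w) → w < M.sOf θ t h →
        h (M.SOf θ t h) + M.K t ≤ h w := by
  have hθ := A.θ_pos
  obtain ⟨hS1, hS2, hS3, hS4⟩ := A.SOf_spec ht h
  have hI := A.Ibar_le_SOf ht h
  by_cases hK : M.K t = 0
  · have e : M.sOf θ t h = M.SOf θ t h := by rw [sOf, if_pos ht, if_pos hK]
    rw [e, hK, add_zero]
    refine ⟨hS1, le_rfl, hI, le_rfl, fun w hw hw' hws => ?_⟩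
    rcases hw' with hw' | hw'
    · exact hS4 w hw hw' (hws.le.trans hS3)
    · exact absurd rfl hw'.1
  · have e : M.sOf θ t h = sInf {w | ∃ m : ℤ, w = z θ m ∧ h (z θ m) ≤ h (M.SOf θ t h) + M.K t ∧
        M.Ibar θ t ≤ z θ m ∧ z θ m ≤ M.SOf θ t h} := by
      rw [sOf, if_pos ht, if_neg hK]
    have g := isLeast_sInf_grid hθ (A := {w | ∃ m : ℤ, w = z θ m ∧
        h (z θ m) ≤ h (M.SOf θ t h) + M.K t ∧ M.Ibar θ t ≤ z θ m ∧ z θ m ≤ M.SOf θ t h})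
      (by rintro w ⟨m, rfl, -⟩; exact ⟨m, rfl⟩) ?_
      ⟨M.Ibar θ t, by rintro w ⟨m, rfl, -, h, -⟩; exact h⟩
    · rw [← e] at g
      obtain ⟨m, h1, h2, h3, h4⟩ := g.1
      refine ⟨⟨m, h1.symm⟩, by rwa [h1], by rwa [h1], by rwa [h1], fun w hw hw' hws => ?_⟩
      by_contra! hc
      obtain ⟨n, rfl⟩ := hw
      refine absurd (g.2 ⟨n, rfl, hc.le, ?_, hws.le.trans (by rwa [h1])⟩) (not_le.2 hws)
      rcases hw' with hw' | hw'
      · exact (A.Ibar_spec ht).2.2.trans hw'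
      · exact hw'.2
    · obtain ⟨m, hm⟩ := hS1
      exact ⟨_, m, rfl, by rw [hm]; linarith [M.K_nonneg t (by omega)], by rwa [hm], hm.le⟩

theorem Admissible.Ybar_spec (A : Admissible M γ θ) {t : ℕ} (ht : t < M.T) :
    M.C t (M.Ybar t) = M.C t (M.Cm t) + M.K t ∧ M.Ybar t ≤ M.Cm t := by
  have hc := A.continuous ht
  have hK := M.K_nonneg t ht
  refine IsClosed.csSup_mem (s := {y | M.C t y = M.C t (M.Cm t) + M.K t ∧ y ≤ M.Cm t})
    ((isClosed_eq hc continuous_const).inter isClosed_Iic) ?_ ⟨M.Cm t, fun y hy => hy.2⟩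
  obtain ⟨a, ha, ha'⟩ := (((A.tendsto_atBot t ht).eventually
    (eventually_ge_atTop (M.C t (M.Cm t) + M.K t))).and (eventually_le_atBot (M.Cm t))).exists
  obtain ⟨y, hy, hy'⟩ := intermediate_value_Icc' ha' hc.continuousOn
    (Set.mem_Icc.2 ⟨(by linarith : M.C t (M.Cm t) ≤ M.C t (M.Cm t) + M.K t), ha⟩)
  exact ⟨y, hy', hy.2⟩

/-! ### The functions `H_t` and `V_t` -/

theorem V_apply (M : InventorySystem P) (θ : ℝ) (t : ℕ) (y : ℝ) : M.V θ t y =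
    if y < M.s θ t then M.H θ t (M.S θ t) + M.K t else M.H θ t y := rfl

theorem V_of_lt {t : ℕ} {y : ℝ} (h : y < M.s θ t) :
    M.V θ t y = M.H θ t (M.S θ t) + M.K t := if_pos h

theorem V_of_le {t : ℕ} {y : ℝ} (h : M.s θ t ≤ y) : M.V θ t y = M.H θ t y := if_neg (not_lt.2 h)

theorem tailConst_V (M : InventorySystem P) (θ : ℝ) (t : ℕ) : TailConst (M.V θ t) :=
  ⟨M.s θ t, _, fun _ h => V_of_lt h⟩

theorem H_last {t : ℕ} (ht : ¬ t + 1 < M.T) : M.H θ t = M.C t := by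
  rw [H, dif_neg ht]

theorem S_last {t : ℕ} (ht : ¬ t + 1 < M.T) : M.S θ t = M.Cm t := by
  rw [S, SOf, if_neg ht]

theorem s_last {t : ℕ} (ht : ¬ t + 1 < M.T) : M.s θ t = M.Ybar t := by
  rw [s, sOf, if_neg ht]

theorem H_step [IsProbabilityMeasure P] (hθ : 0 < θ) {t : ℕ} (ht : t + 1 < M.T) (y : ℝ) :
    M.H θ t y = M.C t y + M.α * ∫ ω, M.V θ (t + 1) (y - M.lowDemand θ t ω) ∂P := by
  rw [← (tailConst_V M θ (t + 1)).discExp_eq M hθ (by omega), H, dif_pos ht]; rfl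

/-- The defining equation of `s_{T-1}` makes the two branches of `V_{T-1}` meet there. This form
serves the last period, where the reorder level may be off the grid. -/
theorem Admissible.V_last (A : Admissible M γ θ) {t : ℕ} (ht : t + 1 = M.T) (y : ℝ) :
    M.V θ t y = M.C t (max y (M.s θ t)) := by
  have ht' : ¬ t + 1 < M.T := by omega
  rcases lt_or_ge y (M.s θ t) with h | h
  · rw [V_of_lt h, max_eq_right h.le, s_last ht', S_last ht', H_last ht',
      (A.Ybar_spec (by omega)).1]
  · rw [V_of_le h, max_eq_left h, H_last ht']

/-- What the next stage uses about the computed policy, on the grid. -/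
structure GridValue (M : InventorySystem P) (θ : ℝ) (t : ℕ) : Prop where
  Ibar_le_s : M.Ibar θ t ≤ M.s θ t
  kConvexOn : KConvexOn (grid θ) (M.K t) (M.V θ t)
  le_add : ∀ x ∈ grid θ, ∀ y ∈ grid θ, x ≤ y → M.V θ t x ≤ M.V θ t y + M.K t

/-- Optimality of the computed policy on the grid. -/
structure GridPolicy (M : InventorySystem P) (θ : ℝ) (t : ℕ) : Prop where
  kConvexOn : KConvexOn (grid θ) (M.K t) (M.H θ t)
  H_S_le : ∀ w ∈ grid θ, M.H θ t (M.S θ t) ≤ M.H θ t w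
  le_of_lt_s : ∀ w ∈ grid θ, w < M.s θ t → M.H θ t (M.S θ t) + M.K t ≤ M.H θ t w

/-- The rounded demand is at least `-θ`, so the margin `θ` in the choice of `I_t` keeps the next
level below `s_{t+1}`, where `V_{t+1}` is constant. -/
theorem Admissible.H_of_le_I [IsProbabilityMeasure P] (A : Admissible M γ θ) {t : ℕ}
    (ht : t + 1 < M.T)
    (h : M.Ibar θ (t + 1) ≤ M.s θ (t + 1)) {y : ℝ} (hy : y ≤ M.I θ t) :
    M.H θ t y = M.C t y + M.α * (M.H θ (t + 1) (M.S θ (t + 1)) + M.K (t + 1)) := by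
  have h1 : ∫ ω, M.V θ (t + 1) (y - M.lowDemand θ t ω) ∂P
      = ∫ _, (M.H θ (t + 1) (M.S θ (t + 1)) + M.K (t + 1)) ∂P := by
    refine integral_congr_ae ?_
    filter_upwards [M.neg_le_lowDemand A.θ_pos (t := t) (by omega)] with ω hω
    have := A.I_lt_Ibar t
    exact V_of_lt (by linarith)
  rw [H_step A.θ_pos ht, h1]; simp

theorem Admissible.gridPolicy [IsProbabilityMeasure P] (A : Admissible M γ θ) {t : ℕ}
    (ht : t + 1 < M.T)
    (hV : GridValue M θ (t + 1)) : GridPolicy M θ t := by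
  have hθ := A.θ_pos
  have hα := M.α_pos
  have hK := M.K_nonneg t (by omega)
  have hKle := A.K_le t ht
  have ht' : t < M.T := by omega
  have hi := fun x => (tailConst_V M θ (t + 1)).integrable M hθ ht' x
  have hmem : ∀ {x}, x ∈ grid θ → ∀ ω, x - M.lowDemand θ t ω ∈ grid θ :=
    fun hx ω => sub_mem_grid hx _
  obtain ⟨hS1, hS2, hS3, hS4⟩ := A.SOf_spec ht (M.H θ t)
  obtain ⟨hs1, hs2, hs3, hs4, hs5⟩ := A.sOf_spec ht (M.H θ t)
  change M.S θ t ∈ _ at hS1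
  change M.I θ t ≤ M.S θ t at hS2
  change M.S θ t ≤ _ at hS3
  have hanti : ∀ x y, x ≤ y → y ≤ M.I θ t → M.H θ t y ≤ M.H θ t x := fun x y hxy hy => by
    rw [A.H_of_le_I ht hV.Ibar_le_s hy, A.H_of_le_I ht hV.Ibar_le_s (hxy.trans hy)]
    linarith [A.C_anti ht' hxy (hy.trans (A.I_lt_Cm t).le)]
  refine ⟨?_, ?_, ?_⟩
  -- `K_{t+1}`-convexity passes through the expectation; discounting turns its constant into `α
  -- K_{t+1} ≤ K_t`.
  · intro a ha b hb c hc hab hbc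
    have h1 := convex_three_point (A.convex t ht') hab hbc
    have h2 : ∫ ω, (c - a) * M.V θ (t + 1) (b - M.lowDemand θ t ω) ∂P
        ≤ ∫ ω, ((c - b) * M.V θ (t + 1) (a - M.lowDemand θ t ω)
          + (b - a) * (M.V θ (t + 1) (c - M.lowDemand θ t ω) + M.K (t + 1))) ∂P := by
      refine integral_mono ((hi b).const_mul _) (((hi a).const_mul _).add
        (((hi c).add (integrable_const _)).const_mul _)) fun ω => ?_
      have := hV.kConvexOn (hmem ha ω) (hmem hb ω) (hmem hc ω) (by linarith) (by linarith)
      simpa only [sub_sub_sub_cancel_right] using this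
    have hic : Integrable (fun ω => M.V θ (t + 1) (c - M.lowDemand θ t ω) + M.K (t + 1)) P :=
      (hi c).add (integrable_const _)
    rw [integral_const_mul, integral_add ((hi a).const_mul _) (hic.const_mul _),
      integral_const_mul, integral_const_mul, integral_add (hi c) (integrable_const _)] at h2
    simp only [integral_const, probReal_univ, one_smul] at h2
    have h3 := mul_le_mul_of_nonneg_left h2 hα.le
    have h4 := mul_le_mul_of_nonneg_left hKle (sub_nonneg.2 hab)
    rw [H_step hθ ht, H_step hθ ht, H_step hθ ht]
    nlinarith
  · intro w hw
    rcases lt_or_ge w (M.I θ t) with h | h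
    · exact (hS4 _ (A.I_mem t) le_rfl (A.I_le_SU ht')).trans (hanti _ _ h.le le_rfl)
    rcases le_or_gt w (M.SU θ t) with h' | h'
    · exact hS4 w hw h h'
    -- Beyond `S^U_t`, compare with the grid point `u` just below `C^m_t`: `C_t` has risen by more
    -- than `K_t`, while the future saves at most `α K_{t+1}`.
    obtain ⟨-, hCS, u, hu, hu1, hu2, hu3⟩ := A.SU_spec ht'
    have hIu : M.I θ t ≤ u := by
      obtain ⟨n, hn⟩ := hu
      obtain ⟨k, hk⟩ := A.I_mem t
      have := A.I_lt_Cm t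
      rw [← hn, ← z_add_one] at hu2
      rw [← hk] at this
      rw [← hn, ← hk, z_le hθ]
      have := (z_lt hθ).1 (this.trans_le hu2)
      omega
    have huw : u ≤ w := by linarith
    refine (hS4 u hu hIu (by linarith)).trans ?_
    have h1 := A.C_mono ht' hCS h'.le
    have h2 : ∫ ω, M.V θ (t + 1) (u - M.lowDemand θ t ω) ∂P
        ≤ ∫ ω, (M.V θ (t + 1) (w - M.lowDemand θ t ω) + M.K (t + 1)) ∂P :=
      integral_mono (hi u) ((hi w).add (integrable_const _)) fun ω =>
        hV.le_add _ (hmem hu ω) _ (hmem hw ω) (by linarith)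
    rw [integral_add (hi w) (integrable_const _)] at h2
    simp only [integral_const, probReal_univ, one_smul] at h2
    have h3 := mul_le_mul_of_nonneg_left h2 hα.le
    rw [H_step hθ ht, H_step hθ ht]
    nlinarith
  · intro w hw hws
    by_cases hIw : M.I θ t ≤ w
    · exact hs5 w hw (Or.inl hIw) hws
    by_cases hK0 : M.K t ≠ 0 ∧ M.Ibar θ t ≤ w
    · exact hs5 w hw (Or.inr hK0) hws
    push Not at hIw hK0
    by_cases hK1 : M.K t = 0
    · rw [hK1, add_zero]
      exact (hS4 _ (A.I_mem t) le_rfl (A.I_le_SU ht')).trans (hanti _ _ hIw.le le_rfl)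
    -- Below `Ī_t`, `H_t` is `C_t` plus a constant, so the gap `C_t(Ī_t - θ) > C_t(I_t) + K_t`
    -- carries over to `H_t`.
    obtain ⟨hg, hC, hle⟩ := A.Ibar_spec ht
    have hwI : w ≤ M.Ibar θ t - θ := by
      have h6 := hK0 hK1
      obtain ⟨n, hn⟩ := hg
      obtain ⟨k, rfl⟩ := hw
      rw [← hn, z_le hθ]
      have : M.Ibar θ t = z θ (n + 1) := by rw [z_add_one, hn]; ring
      rw [this, z_lt hθ] at h6
      omega
    have h7 := hanti _ _ hwI (by linarith)
    have h8 := hS4 _ (A.I_mem t) le_rfl (A.I_le_SU ht')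
    rw [A.H_of_le_I ht hV.Ibar_le_s (by linarith : M.Ibar θ t - θ ≤ M.I θ t)] at h7
    rw [A.H_of_le_I ht hV.Ibar_le_s le_rfl] at h8
    change M.H θ t (M.S θ t) ≤ _ at h8
    linarith

theorem Admissible.gridValue [IsProbabilityMeasure P] (A : Admissible M γ θ)
    : ∀ t < M.T, GridValue M θ t := by
  refine backward_induction (fun t ht => ?_) (fun t ht ih => ?_)
  · have ht' : ¬ t + 1 < M.T := by omega
    have htT : t < M.T := by omega
    have hK := M.K_nonneg t htT
    have hY := A.Ybar_spec htT
    have hs := s_last (θ := θ) ht'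
    -- Work on all of `ℝ` and restrict afterwards: `policy` needs the reorder level in the set, and
    -- `s_{T-1}` may be off the grid.
    have hc := (A.convex t htT).kConvexOn hK Set.univ
    have hm : ∀ c ∈ Set.univ, M.C t (M.Cm t) ≤ M.C t c := fun c _ => A.C_Cm_le htT c
    have e : M.V θ t = fun y => if y < M.Ybar t then M.C t (M.Cm t) + M.K t else M.C t y := by
      funext y
      rw [V_apply, hs, S_last ht', H_last ht']
    refine ⟨by rw [hs, Ibar, dif_neg ht'], ?_, fun x _ y _ hxy => ?_⟩
    · rw [e]
      exact (hc.policy hK (Set.mem_univ _) hY.1.le hm).mono (Set.subset_univ _)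
    · rw [e]
      exact hc.policy_le_add hK (Set.mem_univ _) hY.1.le hm (Set.mem_univ _) (Set.mem_univ _) hxy
  · have hK := M.K_nonneg t (by omega)
    have hp := A.gridPolicy ht ih
    obtain ⟨hs1, hs2, hs3, hs4, -⟩ := A.sOf_spec ht (M.H θ t)
    exact ⟨hs3, hp.kConvexOn.policy hK hs1 hs4 hp.H_S_le, fun x hx y hy hxy =>
      hp.kConvexOn.policy_le_add hK hs1 hs4 hp.H_S_le hx hy hxy⟩

/-! ### Bounds for the increments of `H_t` and `V_t` -/

/-- `φ_t`. -/
def phi (M : InventorySystem P) (θ : ℝ) (γ : ℕ → ℝ) (t : ℕ) : ℝ → ℝ → ℝ :=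
  M.phiOf θ γ t (M.psi θ γ t)

/-- `φ̄_t`. -/
def phiBar (M : InventorySystem P) (θ : ℝ) (γ : ℕ → ℝ) (t : ℕ) : ℝ → ℝ → ℝ :=
  M.phiBarOf θ γ t (M.psiBar θ γ t)

theorem phi_of_lt {t : ℕ} {x y : ℝ} (h : y < M.s θ t) : M.phi θ γ t x y = 0 := if_pos h

theorem phiBar_of_lt {t : ℕ} {x y : ℝ} (h : y < M.s θ t) : M.phiBar θ γ t x y = 0 := if_pos h

theorem phi_last {t : ℕ} (ht : ¬ t + 1 < M.T) {x y : ℝ} (h : M.s θ t ≤ y) :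
    M.phi θ γ t x y = γ t * x := by
  rw [phi, phiOf, if_neg (not_lt.2 h), if_neg ht]

/-- The minimum merges two cases of the definition and makes monotonicity in both arguments visible.
-/
theorem phi_of_le {t : ℕ} (ht : t + 1 < M.T) {x y : ℝ} (h : M.s θ t ≤ y) :
    M.phi θ γ t x y = M.psi θ γ t (min x (y - M.s θ t)) y := by
  rw [phi, phiOf, if_neg (not_lt.2 h), if_pos ht]
  split_ifs with h1
  · rw [min_eq_right (by linarith)]
  · rw [min_eq_left (by linarith)]

theorem tailConst_phi (t : ℕ) (x : ℝ) : TailConst (M.phi θ γ t x) :=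
  ⟨M.s θ t, 0, fun _ h => phi_of_lt h⟩

theorem tailConst_phiBar (t : ℕ) (x : ℝ) : TailConst (M.phiBar θ γ t x) :=
  ⟨M.s θ t, 0, fun _ h => phiBar_of_lt h⟩

theorem integral_lowDemand_eq_zero (hθ : 0 < θ) {t : ℕ} (ht : t < M.T) {g : ℝ → ℝ} {b y : ℝ}
    (hg : ∀ x < b, g x = 0) (hy : y < b - θ) : ∫ ω, g (y - M.lowDemand θ t ω) ∂P = 0 := by
  have : ∫ ω, g (y - M.lowDemand θ t ω) ∂P = ∫ _, (0 : ℝ) ∂P := by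
    refine integral_congr_ae ?_
    filter_upwards [M.neg_le_lowDemand hθ ht] with ω hω
    exact hg _ (by linarith)
  rw [this, integral_zero]

theorem psi_step [IsProbabilityMeasure P] (hθ : 0 < θ) {t : ℕ} (ht : t + 1 < M.T) (x y : ℝ)
    : M.psi θ γ t x y =
    γ t * x + M.α * ∫ ω, M.phi θ γ (t + 1) x (y - M.lowDemand θ t ω) ∂P := by
  rw [psi, dif_pos ht]
  split_ifs with h
  · rw [integral_lowDemand_eq_zero hθ (by omega) (fun _ h => phi_of_lt h) h]; ring
  · rw [← M.sum_Icc_eq_integral (fun _ h => phi_of_lt h) hθ (by omega)]; rfl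

theorem psiBar_step [IsProbabilityMeasure P] (hθ : 0 < θ) {t : ℕ} (ht : t + 1 < M.T) (x y : ℝ)
    : M.psiBar θ γ t x y =
    γ t * x + M.α * ∫ ω, M.phiBar θ γ (t + 1) x (y - M.lowDemand θ t ω) ∂P := by
  rw [psiBar, dif_pos ht]
  split_ifs with h
  · rw [integral_lowDemand_eq_zero hθ (by omega) (fun _ h => phiBar_of_lt h) h]; ring
  · rw [← M.sum_Icc_eq_integral (fun _ h => phiBar_of_lt h) hθ (by omega)]; rfl

theorem psi_last {t : ℕ} (ht : ¬ t + 1 < M.T) (x y : ℝ) : M.psi θ γ t x y = γ t * x := by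
  rw [psi, dif_neg ht]

theorem psiBar_last {t : ℕ} (ht : ¬ t + 1 < M.T) (x y : ℝ) : M.psiBar θ γ t x y = γ t * x := by
  rw [psiBar, dif_neg ht]

/-- Nonnegative for `0 ≤ x`, and there nondecreasing in both arguments. -/
structure IsMonotoneBound (p : ℝ → ℝ → ℝ) : Prop where
  nonneg : ∀ ⦃x⦄, 0 ≤ x → ∀ y, 0 ≤ p x y
  left : ∀ ⦃x x'⦄, 0 ≤ x → x ≤ x' → ∀ y, p x y ≤ p x' y
  right : ∀ ⦃x⦄, 0 ≤ x → ∀ ⦃y y'⦄, y ≤ y' → p x y ≤ p x y'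

theorem Admissible.isMonotoneBound_phi (A : Admissible M γ θ) {t : ℕ} (ht : t < M.T)
    (h : IsMonotoneBound (M.psi θ γ t)) : IsMonotoneBound (M.phi θ γ t) := by
  have hγ := A.γ_nonneg t ht
  have nonneg : ∀ ⦃x⦄, 0 ≤ x → ∀ y, 0 ≤ M.phi θ γ t x y := fun x hx y => by
    rcases lt_or_ge y (M.s θ t) with hy | hy
    · rw [phi_of_lt hy]
    · by_cases ht' : t + 1 < M.T
      · rw [phi_of_le ht' hy]
        exact h.nonneg (le_min hx (by linarith)) _
      · rw [phi_last ht' hy]; positivity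
  refine ⟨nonneg, fun x x' hx hxx' y => ?_, fun x hx y y' hyy' => ?_⟩
  · rcases lt_or_ge y (M.s θ t) with hy | hy
    · rw [phi_of_lt hy, phi_of_lt hy]
    · by_cases ht' : t + 1 < M.T
      · rw [phi_of_le ht' hy, phi_of_le ht' hy]
        exact h.left (le_min hx (by linarith)) (min_le_min_right _ hxx') _
      · rw [phi_last ht' hy, phi_last ht' hy]
        exact mul_le_mul_of_nonneg_left hxx' hγ
  · rcases lt_or_ge y (M.s θ t) with hy | hy
    · rw [phi_of_lt hy]; exact nonneg hx _
    · by_cases ht' : t + 1 < M.T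
      · rw [phi_of_le ht' hy, phi_of_le ht' (hy.trans hyy')]
        exact (h.left (le_min hx (by linarith)) (min_le_min_left _ (by linarith)) _).trans
          (h.right (le_min hx (by linarith)) hyy')
      · rw [phi_last ht' hy, phi_last ht' (hy.trans hyy')]

theorem Admissible.isMonotoneBound_psi [IsProbabilityMeasure P] (A : Admissible M γ θ) :
    ∀ t < M.T, IsMonotoneBound (M.psi θ γ t) := by
  refine backward_induction (fun t ht => ?_) (fun t ht ih => ?_)
  · have ht' : ¬ t + 1 < M.T := by omega
    have hγ := A.γ_nonneg t (by omega)
    refine ⟨fun x hx y => ?_, fun x x' _ hxx' y => ?_, fun x _ y y' _ => ?_⟩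
    · rw [psi_last ht']; positivity
    · rw [psi_last ht', psi_last ht']; exact mul_le_mul_of_nonneg_left hxx' hγ
    · rw [psi_last ht', psi_last ht']
  · have hγ := A.γ_nonneg t (by omega)
    have hα := M.α_pos
    have hp := A.isMonotoneBound_phi ht ih
    have hi := fun x y =>
      (tailConst_phi (M := M) (θ := θ) (γ := γ) (t + 1) x).integrable M A.θ_pos
        (t := t) (by omega) y
    refine ⟨fun x hx y => ?_, fun x x' hx hxx' y => ?_, fun x hx y y' hyy' => ?_⟩
    · rw [psi_step A.θ_pos ht]
      have : 0 ≤ ∫ ω, M.phi θ γ (t + 1) x (y - M.lowDemand θ t ω) ∂P :=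
        integral_nonneg fun ω => hp.nonneg hx _
      positivity
    · rw [psi_step A.θ_pos ht, psi_step A.θ_pos ht]
      exact add_le_add (mul_le_mul_of_nonneg_left hxx' hγ) (mul_le_mul_of_nonneg_left
        (integral_mono (hi x y) (hi x' y) fun ω => hp.left hx hxx' _) hα.le)
    · rw [psi_step A.θ_pos ht, psi_step A.θ_pos ht]
      exact add_le_add le_rfl (mul_le_mul_of_nonneg_left
        (integral_mono (hi x y) (hi x y') fun ω => hp.right hx (by linarith)) hα.le)

theorem Admissible.H_s_le (A : Admissible M γ θ) {t : ℕ} (ht : t < M.T) :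
    M.H θ t (M.s θ t) ≤ M.H θ t (M.S θ t) + M.K t := by
  by_cases ht' : t + 1 < M.T
  · exact (A.sOf_spec ht' (M.H θ t)).2.2.2.1
  · rw [s_last ht', S_last ht', H_last ht']
    exact (A.Ybar_spec ht).1.le

/-- If `y - x` falls below `s_t`, then `V_t (y - x)` is at least `H_t (s_t)`, so only the rise from
`s_t` to `y` counts. -/
theorem Admissible.V_sub_le (A : Admissible M γ θ) {t : ℕ} (ht : t < M.T)
    (h : ∀ x y, 0 ≤ x → M.H θ t y - M.H θ t (y - x) ≤ M.psi θ γ t x y) (x y : ℝ) (hx : 0 ≤ x) :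
    M.V θ t y - M.V θ t (y - x) ≤ M.phi θ γ t x y := by
  rcases lt_or_ge y (M.s θ t) with hy | hy
  · rw [phi_of_lt hy, V_of_lt hy, V_of_lt (by linarith), sub_self]
  have hmin : M.V θ t y - M.V θ t (y - x) ≤ M.psi θ γ t (min x (y - M.s θ t)) y := by
    rcases lt_or_ge (y - x) (M.s θ t) with hyx | hyx
    · rw [V_of_le hy, V_of_lt hyx, min_eq_right (by linarith)]
      have h1 := h (y - M.s θ t) y (by linarith)
      rw [sub_sub_cancel] at h1
      linarith [A.H_s_le ht]
    · rw [V_of_le hy, V_of_le hyx, min_eq_left (by linarith)]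
      exact h x y hx
  by_cases ht' : t + 1 < M.T
  · rwa [phi_of_le ht' hy]
  · rw [psi_last ht'] at hmin
    rw [phi_last ht' hy]
    exact hmin.trans (mul_le_mul_of_nonneg_left (min_le_left _ _) (A.γ_nonneg t ht))

/-- `H_t` rises by at most `ψ_t`. -/
theorem Admissible.H_sub_le [IsProbabilityMeasure P] (A : Admissible M γ θ)
    : ∀ t < M.T, ∀ x y, 0 ≤ x →
    M.H θ t y - M.H θ t (y - x) ≤ M.psi θ γ t x y := by
  have hC : ∀ t < M.T, ∀ x y, 0 ≤ x → M.C t y - M.C t (y - x) ≤ γ t * x := by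
    intro t ht x y hx
    have := (le_abs_self _).trans (A.lip t ht y (y - x))
    rwa [sub_sub_cancel, abs_of_nonneg hx] at this
  refine backward_induction (fun t ht x y hx => ?_) (fun t ht ih x y hx => ?_)
  · have ht' : ¬ t + 1 < M.T := by omega
    rw [psi_last ht', H_last ht']
    exact hC t (by omega) x y hx
  · have hi := fun y => (tailConst_V M θ (t + 1)).integrable M A.θ_pos (t := t) (by omega) y
    have h1 := hC t (by omega) x y hx
    have h2 : ∫ ω, (M.V θ (t + 1) (y - M.lowDemand θ t ω)
        - M.V θ (t + 1) (y - x - M.lowDemand θ t ω)) ∂P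
        ≤ ∫ ω, M.phi θ γ (t + 1) x (y - M.lowDemand θ t ω) ∂P := by
      refine integral_mono ((hi y).sub (hi _))
        ((tailConst_phi (t + 1) x).integrable M A.θ_pos (by omega) y) fun ω => ?_
      have := A.V_sub_le ht ih x (y - M.lowDemand θ t ω) hx
      rwa [sub_right_comm] at this
    rw [integral_sub (hi y) (hi _)] at h2
    have h3 := mul_le_mul_of_nonneg_left h2 M.α_pos.le
    rw [psi_step A.θ_pos ht, H_step A.θ_pos ht, H_step A.θ_pos ht]
    linarith

/-! ### Bounds for the discretization error within a cell -/

/-- A bound for the decrease of `H_t` from a grid point to a point `y` of the cell above it. -/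
def dropBound (M : InventorySystem P) (θ : ℝ) (γ : ℕ → ℝ) (t : ℕ) : ℝ → ℝ :=
  if _h : t + 1 < M.T then fun y => γ t * θ + M.α * ∫ ω,
    (fun u => if u < M.s θ (t + 1) then 0 else dropBound M θ γ (t + 1) u)
      (y - M.lowDemand θ t ω) ∂P
  else fun _ => γ t * θ
termination_by M.T - t
decreasing_by omega

/-- The corresponding bound for `V_t`. -/
def dropBoundV (M : InventorySystem P) (θ : ℝ) (γ : ℕ → ℝ) (t : ℕ) (y : ℝ) : ℝ :=
  if y < M.s θ t then 0 else M.dropBound θ γ t y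

theorem tailConst_dropBoundV (t : ℕ) : TailConst (M.dropBoundV θ γ t) :=
  ⟨M.s θ t, 0, fun _ h => if_pos h⟩

theorem dropBound_last {t : ℕ} (ht : ¬ t + 1 < M.T) (y : ℝ) :
    M.dropBound θ γ t y = γ t * θ := by
  rw [dropBound, dif_neg ht]

theorem dropBound_step {t : ℕ} (ht : t + 1 < M.T) (y : ℝ) : M.dropBound θ γ t y =
    γ t * θ + M.α * ∫ ω, M.dropBoundV θ γ (t + 1) (y - M.lowDemand θ t ω) ∂P := by
  rw [dropBound, dif_pos ht]; rfl

theorem dropBoundV_mono {t : ℕ} (h : ∀ y, 0 ≤ M.dropBound θ γ t y)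
    (h' : Monotone (M.dropBound θ γ t)) : Monotone (M.dropBoundV θ γ t) := by
  intro y y' hyy'
  rw [dropBoundV, dropBoundV]
  split_ifs with h1 h2
  · exact le_rfl
  · exact h y'
  · linarith
  · exact h' hyy'

/-- Monotonicity in `y` allows the error at any `y ≤ S^U_t` to be evaluated at `S^U_t`. -/
theorem Admissible.dropBound_nonneg_mono [IsProbabilityMeasure P] (A : Admissible M γ θ)
    : ∀ t < M.T,
    (∀ y, 0 ≤ M.dropBound θ γ t y) ∧ Monotone (M.dropBound θ γ t) := by
  have hθ := A.θ_pos
  refine backward_induction (fun t ht => ?_) (fun t ht ih => ?_)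
  · have ht' : ¬ t + 1 < M.T := by omega
    have hγ := A.γ_nonneg t (by omega)
    refine ⟨fun y => ?_, fun y y' _ => ?_⟩
    · rw [dropBound_last ht']; positivity
    · rw [dropBound_last ht', dropBound_last ht']
  · have hγ := A.γ_nonneg t (by omega)
    have hα := M.α_pos
    have hi := fun y => (tailConst_dropBoundV (M := M) (θ := θ) (γ := γ) (t + 1)).integrable M hθ
        (t := t) (by omega) y
    refine ⟨fun y => ?_, fun y y' hyy' => ?_⟩
    · rw [dropBound_step ht]
      have : 0 ≤ ∫ ω, M.dropBoundV θ γ (t + 1) (y - M.lowDemand θ t ω) ∂P :=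
        integral_nonneg fun ω => by
          simp only [dropBoundV]
          split_ifs
          · exact le_rfl
          · exact ih.1 _
      positivity
    · rw [dropBound_step ht, dropBound_step ht]
      exact add_le_add le_rfl (mul_le_mul_of_nonneg_left (integral_mono (hi y) (hi y')
        fun ω => dropBoundV_mono ih.1 ih.2 (by linarith)) hα.le)

theorem Admissible.phiBar_left (A : Admissible M γ θ) {t : ℕ} (ht : t < M.T)
    (h : ∀ x x' y, 0 ≤ x → x ≤ x' → M.psiBar θ γ t x y ≤ M.psiBar θ γ t x' y)
    (x x' y : ℝ) (hx : 0 ≤ x) (hxx' : x ≤ x') : M.phiBar θ γ t x y ≤ M.phiBar θ γ t x' y := by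
  have hθ := A.θ_pos
  rw [phiBar, phiBarOf, phiBarOf]
  split_ifs with h1 h2 h3 h4 h5
  · exact le_rfl
  · exact le_rfl
  · linarith
  · exact h _ _ _ hx (by linarith)
  · exact h _ _ _ hx hxx'
  · exact mul_le_mul_of_nonneg_left hxx' (A.γ_nonneg t ht)

theorem Admissible.psiBar_left [IsProbabilityMeasure P] (A : Admissible M γ θ)
    : ∀ t < M.T, ∀ x x' y, 0 ≤ x → x ≤ x' →
    M.psiBar θ γ t x y ≤ M.psiBar θ γ t x' y := by
  refine backward_induction (fun t ht x x' y hx hxx' => ?_) (fun t ht ih x x' y hx hxx' => ?_)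
  · have ht' : ¬ t + 1 < M.T := by omega
    rw [psiBar_last ht', psiBar_last ht']
    exact mul_le_mul_of_nonneg_left hxx' (A.γ_nonneg t (by omega))
  · have hi := fun x =>
      (tailConst_phiBar (M := M) (θ := θ) (γ := γ) (t + 1) x).integrable M A.θ_pos
        (t := t) (by omega) y
    rw [psiBar_step A.θ_pos ht, psiBar_step A.θ_pos ht]
    exact add_le_add (mul_le_mul_of_nonneg_left hxx' (A.γ_nonneg t (by omega)))
      (mul_le_mul_of_nonneg_left (integral_mono (hi x) (hi x') fun ω =>
        A.phiBar_left ht ih x x' _ hx hxx') M.α_pos.le)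

/-- In the middle case of `φ̄`, the first argument `y - s + θ` is at least `θ`, so monotonicity of
`ψ̄` in that argument suffices. -/
theorem Admissible.dropBound_le_psiBar [IsProbabilityMeasure P] (A : Admissible M γ θ)
    : ∀ t < M.T, ∀ y,
    M.dropBound θ γ t y ≤ M.psiBar θ γ t θ y := by
  have hθ := A.θ_pos
  refine backward_induction (fun t ht y => ?_) (fun t ht ih y => ?_)
  · have ht' : ¬ t + 1 < M.T := by omega
    rw [psiBar_last ht', dropBound_last ht']
  · rw [psiBar_step hθ ht, dropBound_step ht]
    refine add_le_add le_rfl (mul_le_mul_of_nonneg_left (integral_mono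
      ((tailConst_dropBoundV (t + 1)).integrable M hθ (by omega) y)
      ((tailConst_phiBar (t + 1) θ).integrable M hθ (by omega) y) fun ω => ?_) M.α_pos.le)
    simp only [dropBoundV, phiBar, phiBarOf]
    split_ifs with h1 h2 h3
    · exact le_rfl
    · exact (ih _).trans (A.psiBar_left _ ht _ _ _ hθ.le (by linarith))
    · exact ih _
    · rw [dropBound_last h2]

/-- Before the last period `s_t` is a grid point, so no cell straddles it. In the last period the
convex estimate is applied to cells truncated at `s_t`. -/
theorem Admissible.cell_increment_V (A : Admissible M γ θ) {t : ℕ} (ht : t < M.T)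
    (h : ∀ x y, x ≤ y → M.H θ t x - M.H θ t (gridFloor θ x)
      + (M.H θ t (gridFloor θ y) - M.H θ t y) ≤ M.dropBound θ γ t y) (x y : ℝ) (hxy : x ≤ y) :
    M.V θ t x - M.V θ t (gridFloor θ x) + (M.V θ t (gridFloor θ y) - M.V θ t y)
      ≤ M.dropBoundV θ γ t y := by
  have hθ := A.θ_pos
  have hx1 := gridFloor_le hθ x
  have hx2 := lt_gridFloor_add hθ x
  have hy1 := gridFloor_le hθ y
  have hy2 := lt_gridFloor_add hθ y
  have hm := gridFloor_mono hθ hxy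
  by_cases ht' : t + 1 < M.T
  · have hs := (A.sOf_spec ht' (M.H θ t)).1
    change M.s θ t ∈ grid θ at hs
    have hfx := le_gridFloor_iff hθ hs (y := x)
    have hfy := le_gridFloor_iff hθ hs (y := y)
    rw [dropBoundV]
    split_ifs with hy
    · rw [V_of_lt hy, V_of_lt (by linarith : x < _), V_of_lt (by linarith : gridFloor θ y < _),
        V_of_lt (by linarith : gridFloor θ x < _)]
      linarith
    · have hy := not_lt.1 hy
      rw [V_of_le hy, V_of_le (hfy.2 hy)]
      rcases lt_or_ge x (M.s θ t) with hx | hx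
      · rw [V_of_lt hx, V_of_lt (by linarith : gridFloor θ x < _)]
        -- `V_t` is constant on the cell of `x`; taking a grid point as left argument of `h`
        -- isolates the drop at `y`.
        have := h (gridFloor θ y) y hy1
        rw [gridFloor_of_mem hθ (gridFloor_mem θ y)] at this
        linarith
      · rw [V_of_le hx, V_of_le (hfx.2 hx)]
        exact h x y hxy
  · have hl : t + 1 = M.T := by omega
    rw [A.V_last hl, A.V_last hl, A.V_last hl, A.V_last hl, dropBoundV]
    set s := M.s θ t
    split_ifs with hy
    · rw [max_eq_right hy.le, max_eq_right (by linarith : x ≤ s),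
        max_eq_right (by linarith : gridFloor θ y ≤ s),
        max_eq_right (by linarith : gridFloor θ x ≤ s)]
      linarith
    · rw [dropBound_last ht']
      have key : ∀ u v : ℝ, u ≤ v → v ≤ u + θ →
          0 ≤ max v s - max u s ∧ max v s - max u s ≤ θ := by
        intro u v h1 h2
        refine ⟨sub_nonneg.2 (max_le_max_right s h1), ?_⟩
        rw [sub_le_iff_le_add, max_le_iff]
        constructor <;> linarith [le_max_left u s, le_max_right u s]
      obtain ⟨hρ, hρ'⟩ := key _ _ hx1 hx2.le
      obtain ⟨hσ, hσ'⟩ := key _ _ hy1 hy2.le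
      have := convex_lipschitz_increment (A.convex t ht) (A.γ_nonneg t ht) (A.lip t ht)
        (max_le_max_right s hm) hρ hρ' hσ hσ'
      rw [add_sub_cancel, add_sub_cancel] at this
      linarith

/-- The increase of `H_t` within the cell of `x` and its decrease within the cell of `y ≥ x` are
together bounded by `dropBound`, since the convex parts compensate each other. -/
theorem Admissible.cell_increment [IsProbabilityMeasure P] (A : Admissible M γ θ)
    : ∀ t < M.T, ∀ x y, x ≤ y →
    M.H θ t x - M.H θ t (gridFloor θ x) + (M.H θ t (gridFloor θ y) - M.H θ t y)
      ≤ M.dropBound θ γ t y := by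
  have hθ := A.θ_pos
  have hC : ∀ t < M.T, ∀ x y, x ≤ y → M.C t x - M.C t (gridFloor θ x)
      + (M.C t (gridFloor θ y) - M.C t y) ≤ γ t * θ := by
    intro t ht x y hxy
    have := convex_lipschitz_increment (A.convex t ht) (A.γ_nonneg t ht) (A.lip t ht)
      (gridFloor_mono hθ hxy) (sub_nonneg.2 (gridFloor_le hθ x))
      (by linarith [lt_gridFloor_add hθ x] : _ ≤ θ) (sub_nonneg.2 (gridFloor_le hθ y))
      (by linarith [lt_gridFloor_add hθ y])
    rw [add_sub_cancel, add_sub_cancel] at this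
    linarith
  refine backward_induction (fun t ht x y hxy => ?_) (fun t ht ih x y hxy => ?_)
  · have ht' : ¬ t + 1 < M.T := by omega
    rw [H_last ht', dropBound_last ht']
    exact hC t (by omega) x y hxy
  · have hi := fun y => (tailConst_V M θ (t + 1)).integrable M hθ (t := t) (by omega) y
    have h1 := hC t (by omega) x y hxy
    have h2 : ∫ ω, (M.V θ (t + 1) (x - M.lowDemand θ t ω)
          - M.V θ (t + 1) (gridFloor θ x - M.lowDemand θ t ω)
        + (M.V θ (t + 1) (gridFloor θ y - M.lowDemand θ t ω)
          - M.V θ (t + 1) (y - M.lowDemand θ t ω))) ∂P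
        ≤ ∫ ω, M.dropBoundV θ γ (t + 1) (y - M.lowDemand θ t ω) ∂P := by
      refine integral_mono (((hi _).sub (hi _)).add ((hi _).sub (hi _)))
        ((tailConst_dropBoundV (t + 1)).integrable M hθ (by omega) y) fun ω => ?_
      have := A.cell_increment_V ht ih (x - M.lowDemand θ t ω) (y - M.lowDemand θ t ω)
        (by linarith)
      rwa [lowDemand, gridFloor_sub hθ, gridFloor_sub hθ] at this
    have hs := fun u v => (hi u).sub (hi v)
    simp only [Pi.sub_def] at hs
    rw [integral_add (hs _ _) (hs _ _), integral_sub (hi _) (hi _),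
      integral_sub (hi _) (hi _)] at h2
    have h3 := mul_le_mul_of_nonneg_left h2 M.α_pos.le
    rw [dropBound_step ht, H_step hθ ht, H_step hθ ht, H_step hθ ht, H_step hθ ht]
    linarith

theorem Admissible.H_gridFloor_sub_le [IsProbabilityMeasure P] (A : Admissible M γ θ) {t : ℕ}
    (ht : t < M.T) (y : ℝ) :
    M.H θ t (gridFloor θ y) - M.H θ t y ≤ M.dropBound θ γ t y := by
  have := A.cell_increment t ht (gridFloor θ y) y (gridFloor_le A.θ_pos y)
  rw [gridFloor_of_mem A.θ_pos (gridFloor_mem θ y)] at this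
  linarith

/-! ### The error estimate -/

theorem omegaBar_last {t : ℕ} (ht : ¬ t + 1 < M.T) (x : ℝ) : M.omegaBar θ γ t x = 0 := by
  rw [omegaBar, omegaBarOf, if_neg ht]

theorem omegaBar_of_le {t : ℕ} (ht : t + 1 < M.T) {x : ℝ} (hx : x ≤ M.SU θ t) :
    M.omegaBar θ γ t x = M.psiBar θ γ t θ (M.SU θ t) + M.omega θ γ t (M.SU θ t) := by
  rw [omegaBar, omegaBarOf, if_pos ht, if_pos hx]

theorem omegaBar_of_gt {t : ℕ} (ht : t + 1 < M.T) {x : ℝ} (hx : M.SU θ t < x) :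
    M.omegaBar θ γ t x =
      max (M.psiBar θ γ t θ (M.SU θ t) + M.omega θ γ t (M.SU θ t)) (M.omega θ γ t x) := by
  rw [omegaBar, omegaBarOf, if_pos ht, if_neg (not_le.2 hx)]

theorem tailConst_omegaBar (t : ℕ) : TailConst (M.omegaBar θ γ t) := by
  by_cases ht : t + 1 < M.T
  · exact ⟨M.SU θ t, _, fun x hx => omegaBar_of_le ht hx.le⟩
  · exact ⟨0, 0, fun x _ => omegaBar_last ht x⟩

theorem omega_step [IsProbabilityMeasure P] (hθ : 0 < θ) {t : ℕ} (ht : t + 1 < M.T) (x : ℝ) :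
    M.omega θ γ t x = M.psi θ γ t θ x - γ t * θ
      + M.α * ∫ ω, M.omegaBar θ γ (t + 1) (x - M.lowDemand θ t ω) ∂P := by
  rw [← (tailConst_omegaBar (t + 1)).discExp_eq M hθ (by omega), omega, dif_pos ht]; rfl

theorem Admissible.omega_mono [IsProbabilityMeasure P] (A : Admissible M γ θ) {t : ℕ}
    (ht : t + 1 < M.T) (h : Monotone (M.omegaBar θ γ (t + 1))) :
    Monotone (M.omega θ γ t) := by
  intro x y hxy
  have hi := fun y => (tailConst_omegaBar (M := M) (θ := θ) (γ := γ) (t + 1)).integrable M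
    A.θ_pos (t := t) (by omega) y
  have h1 := (A.isMonotoneBound_psi t (by omega)).right A.θ_pos.le hxy
  have h2 := mul_le_mul_of_nonneg_left (integral_mono (hi x) (hi y) fun ω =>
    h (by linarith : x - M.lowDemand θ t ω ≤ y - M.lowDemand θ t ω)) M.α_pos.le
  rw [omega_step A.θ_pos ht, omega_step A.θ_pos ht]
  linarith

theorem omegaBar_mono {t : ℕ} (ht : t + 1 < M.T) (h : Monotone (M.omega θ γ t)) :
    Monotone (M.omegaBar θ γ t) := by
  intro x y hxy
  rcases le_or_gt y (M.SU θ t) with hy | hy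
  · rw [omegaBar_of_le ht hy, omegaBar_of_le ht (hxy.trans hy)]
  · rw [omegaBar_of_gt ht hy]
    rcases le_or_gt x (M.SU θ t) with hx | hx
    · rw [omegaBar_of_le ht hx]; exact le_max_left _ _
    · rw [omegaBar_of_gt ht hx]; exact max_le_max_left _ (h hxy)

/-- The intermediate value `V_{t+1}(x - D_t)` is used only pointwise and never integrated.
Monotonicity of `ω̄_{t+1}` moves its argument from `x - D_t` to `x - lowDemand`. -/
theorem Admissible.H_sub_Hstar_le [IsProbabilityMeasure P] (A : Admissible M γ θ) {t : ℕ}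
    (ht : t + 1 < M.T) (hm : Monotone (M.omegaBar θ γ (t + 1)))
    (hV : ∀ x, M.V θ (t + 1) x - M.Vstar (t + 1) x ≤ M.omegaBar θ γ (t + 1) x) (x : ℝ) :
    M.H θ t x - M.Hstar t x ≤ M.omega θ γ t x := by
  have hθ := A.θ_pos
  have ht' : t < M.T := by omega
  have i1 := (tailConst_V M θ (t + 1)).integrable M hθ ht' x
  have i2 := (A.Vstar_lipBelow (t + 1) ht.le).integrable ht' x
  have i3 := (tailConst_phi (M := M) (θ := θ) (γ := γ) (t + 1) θ).integrable M hθ ht' x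
  have i4 := (tailConst_omegaBar (M := M) (θ := θ) (γ := γ) (t + 1)).integrable M hθ ht' x
  have h2 : ∫ ω, (M.V θ (t + 1) (x - M.lowDemand θ t ω) - M.Vstar (t + 1) (x - M.D t ω)) ∂P
      ≤ ∫ ω, (M.phi θ γ (t + 1) θ (x - M.lowDemand θ t ω)
        + M.omegaBar θ γ (t + 1) (x - M.lowDemand θ t ω)) ∂P := by
    refine integral_mono (i1.sub i2) (i3.add i4) fun ω => ?_
    have h1 := M.lowDemand_lt hθ t ω
    have h2 := M.le_lowDemand_add hθ t ω
    have h3 := A.V_sub_le ht (A.H_sub_le (t + 1) ht) (M.D t ω - M.lowDemand θ t ω)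
      (x - M.lowDemand θ t ω) (by linarith)
    rw [sub_sub_sub_cancel_right] at h3
    have h4 := (A.isMonotoneBound_phi ht (A.isMonotoneBound_psi (t + 1) ht)).left
      (by linarith : 0 ≤ M.D t ω - M.lowDemand θ t ω) (by linarith : _ ≤ θ)
      (x - M.lowDemand θ t ω)
    have h5 := hV (x - M.D t ω)
    have h6 := hm (by linarith : x - M.D t ω ≤ x - M.lowDemand θ t ω)
    simp only
    linarith
  rw [integral_sub i1 i2, integral_add i3 i4] at h2
  have h3 := mul_le_mul_of_nonneg_left h2 M.α_pos.le
  rw [omega_step hθ ht, psi_step hθ ht, H_step hθ ht, Hstar]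
  linarith

/-- Nothing is rounded in the last period: `s` and `S` are the exact policy for the convex cost
`C_{T-1}`. -/
theorem Admissible.V_sub_Vstar_le_last [IsProbabilityMeasure P] (A : Admissible M γ θ) {t : ℕ}
    (ht : t + 1 = M.T) (x : ℝ) : M.V θ t x ≤ M.Vstar t x := by
  have htT : t < M.T := by omega
  obtain ⟨h1, h2⟩ := A.Ybar_spec htT
  have hK := M.K_nonneg t htT
  have hs : M.s θ t = M.Ybar t := s_last (by omega)
  have hCm := A.C_Cm_le htT
  rw [A.V_last ht, hs]
  refine A.le_Vstar htT ?_ fun y hxy => ?_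
  · rw [Hstar_last ht]
    rcases le_total x (M.Ybar t) with h | h
    · rw [max_eq_right h]; exact A.C_anti htT h h2
    · rw [max_eq_left h]
  · rw [Hstar_last ht]
    rcases le_total (max x (M.Ybar t)) (M.Cm t) with h | h
    · have := A.C_anti htT (le_max_right x (M.Ybar t)) h
      linarith [hCm y]
    · rcases le_total x (M.Ybar t) with h' | h'
      · rw [max_eq_right h', h1]; linarith [hCm y]
      · rw [max_eq_left h'] at h ⊢
        have := A.C_mono htT h hxy
        linarith

theorem Admissible.V_sub_Vstar_le [IsProbabilityMeasure P] (A : Admissible M γ θ) {t : ℕ}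
    (ht : t + 1 < M.T) (hω : Monotone (M.omega θ γ t))
    (hH : ∀ x, M.H θ t x - M.Hstar t x ≤ M.omega θ γ t x) (x : ℝ) :
    M.V θ t x - M.Vstar t x ≤ M.omegaBar θ γ t x := by
  have hθ := A.θ_pos
  have htT : t < M.T := by omega
  have hK := M.K_nonneg t htT
  have hp := A.gridPolicy ht (A.gridValue (t + 1) ht)
  obtain ⟨hsg, hsS, -, hHs, -⟩ := A.sOf_spec ht (M.H θ t)
  have hSU := (A.SOf_spec ht (M.H θ t)).2.2.1
  change M.s θ t ∈ _ at hsg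
  change M.s θ t ≤ M.S θ t at hsS
  change M.S θ t ≤ _ at hSU
  change M.H θ t (M.s θ t) ≤ M.H θ t (M.S θ t) + M.K t at hHs
  obtain ⟨hd0, hdm⟩ := A.dropBound_nonneg_mono t htT
  have hdψ := A.dropBound_le_psiBar t htT (M.SU θ t)
  have hdrop := A.H_gridFloor_sub_le htT
  have hdU : ∀ y ≤ M.SU θ t, M.dropBound θ γ t y + M.omega θ γ t y
      ≤ M.psiBar θ γ t θ (M.SU θ t) + M.omega θ γ t (M.SU θ t) := fun y hy => by
    linarith [hdm hy, hω hy]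
  have hnoOrder : M.V θ t x - M.omegaBar θ γ t x ≤ M.Hstar t x := by
    have hHx := hH x
    rcases lt_or_ge x (M.s θ t) with hx | hx
    · have hxU : x ≤ M.SU θ t := by linarith
      rw [V_of_lt hx, omegaBar_of_le ht hxU]
      have h1 := hp.le_of_lt_s _ (gridFloor_mem θ x) ((gridFloor_le hθ x).trans_lt hx)
      linarith [hdrop x, hdU x hxU]
    · rw [V_of_le hx]
      rcases le_or_gt x (M.SU θ t) with hxU | hxU
      · rw [omegaBar_of_le ht hxU]
        linarith [hdU x hxU, hd0 x]
      · rw [omegaBar_of_gt ht hxU]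
        linarith [le_max_right (M.psiBar θ γ t θ (M.SU θ t) + M.omega θ γ t (M.SU θ t))
          (M.omega θ γ t x)]
  -- Below `s_t` only `y` needs rounding. Above it both points are rounded: grid `K`-convexity
  -- compares the floors and `cell_increment` bounds the joint rounding error.
  have horder : ∀ y, x ≤ y → y ≤ M.SU θ t →
      M.V θ t x - M.omegaBar θ γ t x ≤ M.K t + M.Hstar t y := by
    intro y hxy hyU
    have hHy := hH y
    have hU := hdU y hyU
    rw [omegaBar_of_le ht (hxy.trans hyU)]
    rcases lt_or_ge x (M.s θ t) with hx | hx
    · rw [V_of_lt hx]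
      linarith [hdrop y, hp.H_S_le _ (gridFloor_mem θ y)]
    · rw [V_of_le hx]
      have h1 := A.cell_increment t htT x y hxy
      have h2 := hp.kConvexOn.le_add hK hsg hHs (gridFloor_mem θ x) (gridFloor_mem θ y)
        (hp.H_S_le _ (gridFloor_mem θ y)) ((le_gridFloor_iff hθ hsg).2 hx) (gridFloor_mono hθ hxy)
      linarith
  suffices M.V θ t x - M.omegaBar θ γ t x ≤ M.Vstar t x by linarith
  refine A.le_Vstar htT hnoOrder fun y hxy => ?_
  -- To the right of `C^m_t` an order raises `C_t` and saves at most `K_t` later, so not ordering is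
  -- no worse.
  rcases le_total (M.Cm t) x with hx | hx
  · have := A.Hstar_sub_le ht hxy
    linarith [A.C_mono htT hx hxy]
  rcases le_or_gt y (M.SU θ t) with hy | hy
  · exact horder y hxy hy
  -- Replace `y > S^U_t` by `max x w`: the drop in `C_t` exceeds `K_t`, which covers the possible
  -- loss in later periods.
  obtain ⟨-, hCU, w, -, hw, -, hwU⟩ := A.SU_spec (θ := θ) htT
  have hm : max x w ≤ M.Cm t := max_le hx hw.le
  refine (horder (max x w) (le_max_left _ _) (hm.trans hCU)).trans ?_
  have h1 := A.Hstar_sub_le ht (by linarith : max x w ≤ y)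
  have h2 := A.C_anti htT (le_max_right x w) hm
  have h3 := A.C_mono htT hCU hy.le
  linarith

theorem Admissible.error_estimate [IsProbabilityMeasure P] (A : Admissible M γ θ) :
    ∀ t < M.T, Monotone (M.omegaBar θ γ t) ∧ ∀ x,
      M.H θ t x - M.Hstar t x ≤ M.omega θ γ t x ∧
      M.V θ t x - M.Vstar t x ≤ M.omegaBar θ γ t x := by
  refine backward_induction (fun t ht => ?_) (fun t ht ih => ?_)
  · have ht' : ¬ t + 1 < M.T := by omega
    refine ⟨fun x y _ => by rw [omegaBar_last ht', omegaBar_last ht'], fun x => ⟨?_, ?_⟩⟩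
    · rw [H_last ht', Hstar_last ht, omega, dif_neg ht', sub_self]
    · rw [omegaBar_last ht']
      linarith [A.V_sub_Vstar_le_last ht x]
  · have hω := A.omega_mono ht ih.1
    have hH := A.H_sub_Hstar_le ht ih.1 fun x => (ih.2 x).2
    exact ⟨omegaBar_mono ht hω, fun x => ⟨hH x, A.V_sub_Vstar_le ht hω hH x⟩⟩

end

end InventorySystem

theorem theorem4p2 {Ω : Type*} [MeasurableSpace Ω] (P : Measure Ω) [IsProbabilityMeasure P]
    (M : InventorySystem P)
    (hconvex : ∀ t < M.T, ConvexOn ℝ Set.univ (M.C t))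
    (hcoercive : ∀ t < M.T, Tendsto (M.C t) atTop atTop ∧ Tendsto (M.C t) atBot atTop)
    (hK : ∀ t, t + 1 < M.T → M.α * M.K (t + 1) ≤ M.K t)
    (γ : ℕ → ℝ) (hγ : ∀ t < M.T, 0 ≤ γ t)
    (hLip : ∀ t < M.T, ∀ x y : ℝ, |M.C t x - M.C t y| ≤ γ t * |x - y|)
    (θ : ℝ) (hθ : 0 < θ) :
    ∀ t < M.T, ∀ x : ℝ,
      M.H θ t x - M.Hstar t x ≤ M.omega θ γ t x ∧
      M.V θ t x - M.Vstar t x ≤ M.omegaBar θ γ t x := by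
  have A : InventorySystem.Admissible M γ θ :=
    ⟨hconvex, fun t ht => (hcoercive t ht).1, fun t ht => (hcoercive t ht).2, hK, hγ, hLip, hθ⟩
  exact fun t ht => (A.error_estimate t ht).2
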